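/- Let $a,b,k$ be integers with $1\le a<b$, $\gcd(a,b)=1$, $k\ge 1$, $ka>1$; put $A=(a,b)$, $A'=(1,ka,kb)$, $\mathbb{N}A=\mathbb{N}a+\mathbb{N}b$, and let $\beta\in\mathbb{C}$ and $s\ge b/a$ be real. Let $X'=\mathbb{C}^3$ with coordinates $(x_0,x_1,x_2)$, $X=\{x_0=0\}=\mathbb{C}^2$, $Y'=\{x_2=0\}\subset X'$, $Y=X\cap Y'$, and fix $\varepsilon\in\mathbb{C}\setminus\{0\}$. A germ of Gevrey series of order at most $s$ along $Y'$ at $(0,\varepsilon,0)$ (resp. along $Y$ at $(\varepsilon,0)$) is a formal series $\sum_{m\ge0}f_m x_2^m$, with all $f_m$ holomorphic in a common neighbourhood of $(0,\varepsilon)$ in $Y'$ (resp. of $\varepsilon$ in $Y$), such that $\sum_m f_m\,(m!)^{1-s}x_2^m$ converges to a holomorphic germ. For a row $B=(b_i)$ of positive integers let $H_B(\beta)$ be the left ideal of the Weyl algebra generated by all $\partial^u-\partial^v$ with $u,v$ vectors of natural numbers, $Bu=Bv$, and by $\sum_i b_ix_i\partial_i-\beta$, and let $M_B(\beta)$ be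 the quotient of the Weyl algebra by it. Let $\mathrm{Sol}(M_{B}(\beta))$ be the space of germs of Gevrey series of order at most $s$ annihilated by $H_B(\beta)$, at the point $(0,\varepsilon,0)$ along $Y'$ when $B=A'$ and at $(\varepsilon,0)$ along $Y$ when $B=A$. For $\beta'\in\mathbb{C}$ and $0\le j<a$, and for a fixed holomorphic branch of $\log x_1$ near $\varepsilon$, put $$\psi^{(j)}_{A,\beta'}=\sum_{m\ge 0}\frac{\left[\frac{\beta'-jb}{a}\right]_{bm}}{[am+j]_{am}}\,x_1^{\frac{\beta'-jb}{a}-bm}\,x_2^{am+j},\qquad [z]_n=z(z-1)\cdots(z-n+1).$$ Then the linear map $$\varpi_\beta^s:\ \mathrm{Sol}(M_{A'}(\beta))\to\bigoplus_{\ell=0}^{k-1}\mathrm{Sol}\left(M_{A}\left(\tfrac{\beta-\ell}{k}\right)\right),\qquad \varphi\mapsto\left(\frac{\partial^\ell\varphi}{\partial x_0^\ell}(0,x_1,x_2)\right)_{0\le\ell<k}$$ is well defined, and: 1) If $\beta\notin\mathbb{N}$ or $\beta\in\bigcup_{r=0}^{k-1}(r+k\,\mathbb{N}A)$, then $\varpi_\beta^s$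 is an isomorphism of vector spaces. 2) If $\beta\in\bigcup_{r=0}^{k-1}\left(r+k(\mathbb{N}\setminus\mathbb{N}A)\right)$, there are unique integers $j_0,r_0,q_0,h$ and $j'_0$ with $0\le j_0<ka$, $0\le r_0<k$, $q_0\ge 0$, $\beta=j_0+kah=r_0+kq_0+kah$, $0\le j'_0<a$ and $bj'_0\equiv q_0\pmod a$. The image of $\varpi_\beta^s$ has codimension $1$ in $\bigoplus_{\ell<k}\mathrm{Sol}(M_A((\beta-\ell)/k))$, and it is generated by the vectors $(0,\dots,0,\psi^{(j')}_{A,(\beta-r)/k},0,\dots,0)$ with the nonzero entry in position $r$, for all $0\le r<k$ and $0\le j'<a$ with $(j',r)\ne(j'_0,r_0)$. -/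

import Mathlib

open Filter Topology

noncomputable section

namespace GevreyGKZ

/-! ### Formal series along a coordinate hyperplane

`X = ℂ^(d+1)` has coordinates `x_i`, `i : Fin (d+1)`, and `Y ⊆ X` is the hyperplane on which the
last coordinate vanishes; `Y` is identified with `Fin d → ℂ`. A family `f y m` stands for the
formal series `∑ₘ f_m(y) tᵐ`, where `t` is the last coordinate. -/

/-- All the coefficients `f_m` are holomorphic in a common neighbourhood of `p`. -/
def HolAlong {d : ℕ} (p : Fin d → ℂ) (f : (Fin d → ℂ) → ℕ → ℂ) : Prop :=
  ∀ᶠ y in 𝓝 p, ∀ m, AnalyticAt ℂ (fun z => f z m) y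

theorem HolAlong.add {d : ℕ} {p : Fin d → ℂ} {f g : (Fin d → ℂ) → ℕ → ℂ}
    (hf : HolAlong p f) (hg : HolAlong p g) : HolAlong p (f + g) := by
  filter_upwards [hf, hg] with y h1 h2 m
  exact (h1 m).add (h2 m)

theorem HolAlong.smul {d : ℕ} {p : Fin d → ℂ} {f : (Fin d → ℂ) → ℕ → ℂ} (c : ℂ)
    (hf : HolAlong p f) : HolAlong p (c • f) := by
  filter_upwards [hf] with y h1 m
  exact analyticAt_const.mul (h1 m)

/-- The germs at `p` of families `f` with coefficients holomorphic in a common neighbourhood. -/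
def formalGerms {d : ℕ} (p : Fin d → ℂ) : Submodule ℂ (Germ (𝓝 p) (ℕ → ℂ)) where
  carrier := {F | ∃ f : (Fin d → ℂ) → ℕ → ℂ, HolAlong p f ∧ (f : Germ (𝓝 p) (ℕ → ℂ)) = F}
  add_mem' := by
    rintro _ _ ⟨f, hf, rfl⟩ ⟨g, hg, rfl⟩
    exact ⟨f + g, hf.add hg, rfl⟩
  zero_mem' := ⟨0, Eventually.of_forall fun _ _ => analyticAt_const, rfl⟩
  smul_mem' := by
    rintro c _ ⟨f, hf, rfl⟩
    exact ⟨c • f, hf.smul c, rfl⟩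

/-- The stalk at `(p, 0) ∈ Y` of the formal completion of `𝒪_X` along `Y`. -/
def FormalGerm {d : ℕ} (p : Fin d → ℂ) : Type := formalGerms p

instance {d : ℕ} (p : Fin d → ℂ) : AddCommGroup (FormalGerm p) :=
  inferInstanceAs (AddCommGroup (formalGerms p))

instance {d : ℕ} (p : Fin d → ℂ) : Module ℂ (FormalGerm p) :=
  inferInstanceAs (Module ℂ (formalGerms p))

/-- The germ at `(p, 0)` of the formal series `∑ₘ f_m(y) tᵐ`. -/
def FormalGerm.mk {d : ℕ} {p : Fin d → ℂ} (f : (Fin d → ℂ) → ℕ → ℂ) (hf : HolAlong p f) :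
    FormalGerm p :=
  ⟨(f : Germ (𝓝 p) (ℕ → ℂ)), f, hf, rfl⟩

theorem FormalGerm.exists_mk {d : ℕ} {p : Fin d → ℂ} (F : FormalGerm p) :
    ∃ f, ∃ hf : HolAlong p f, F = FormalGerm.mk f hf := by
  obtain ⟨_, f, hf, rfl⟩ := F
  exact ⟨f, hf, rfl⟩

theorem FormalGerm.mk_eq_mk {d : ℕ} {p : Fin d → ℂ} {f g : (Fin d → ℂ) → ℕ → ℂ}
    (hf : HolAlong p f) (hg : HolAlong p g) :
    FormalGerm.mk f hf = FormalGerm.mk g hg ↔ f =ᶠ[𝓝 p] g := by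
  rw [← Germ.coe_eq]
  exact Subtype.ext_iff

/-- The linear map on germs induced by an operation on representatives. -/
def liftOp {d e : ℕ} {p : Fin d → ℂ} {q : Fin e → ℂ}
    (T : ((Fin d → ℂ) → ℕ → ℂ) → ((Fin e → ℂ) → ℕ → ℂ))
    (hcongr : ∀ f g, f =ᶠ[𝓝 p] g → T f =ᶠ[𝓝 q] T g)
    (hol : ∀ f, HolAlong p f → HolAlong q (T f))
    (hadd : ∀ f g, HolAlong p f → HolAlong p g → T (f + g) =ᶠ[𝓝 q] T f + T g)
    (hsmul : ∀ (c : ℂ) f, HolAlong p f → T (c • f) =ᶠ[𝓝 q] c • T f) :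
    FormalGerm p →ₗ[ℂ] FormalGerm q where
  toFun F := ⟨Quotient.map' T hcongr F.1, by
    obtain ⟨_, f, hf, rfl⟩ := F
    exact ⟨T f, hol f hf, rfl⟩⟩
  map_add' := by
    rintro ⟨_, f, hf, rfl⟩ ⟨_, g, hg, rfl⟩
    exact Subtype.ext (Germ.coe_eq.2 (hadd f g hf hg))
  map_smul' := by
    rintro c ⟨_, f, hf, rfl⟩
    exact Subtype.ext (Germ.coe_eq.2 (hsmul c f hf))

theorem liftOp_mk {d e : ℕ} {p : Fin d → ℂ} {q : Fin e → ℂ}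
    {T : ((Fin d → ℂ) → ℕ → ℂ) → ((Fin e → ℂ) → ℕ → ℂ)}
    {hcongr : ∀ f g, f =ᶠ[𝓝 p] g → T f =ᶠ[𝓝 q] T g}
    {hol : ∀ f, HolAlong p f → HolAlong q (T f)}
    {hadd : ∀ f g, HolAlong p f → HolAlong p g → T (f + g) =ᶠ[𝓝 q] T f + T g}
    {hsmul : ∀ (c : ℂ) f, HolAlong p f → T (c • f) =ᶠ[𝓝 q] c • T f}
    (f : (Fin d → ℂ) → ℕ → ℂ) (hf : HolAlong p f) :
    liftOp T hcongr hol hadd hsmul (FormalGerm.mk f hf) = FormalGerm.mk (T f) (hol f hf) :=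
  rfl

/-! ### Coordinates and partial derivatives -/

/-- Multiplication by a coordinate `x_i` of `Y`. -/
def mulBase {d : ℕ} (p : Fin d → ℂ) (i : Fin d) : Module.End ℂ (FormalGerm p) :=
  liftOp (fun f y m => y i * f y m)
    (by
      intro f g h
      filter_upwards [h] with y hy
      simp only [hy])
    (by
      intro f hf
      filter_upwards [hf] with y hy m
      exact ((ContinuousLinearMap.proj (R := ℂ) (φ := fun _ : Fin d => ℂ) i).analyticAt y).mul
        (hy m))
    (by
      intro f g _ _
      refine Eventually.of_forall fun y => ?_
      funext m
      simp [mul_add])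
    (by
      intro c f _
      refine Eventually.of_forall fun y => ?_
      funext m
      simp only [Pi.smul_apply, smul_eq_mul]
      ring)

/-- Multiplication by the last coordinate `t`. -/
def mulNormal {d : ℕ} (p : Fin d → ℂ) : Module.End ℂ (FormalGerm p) :=
  liftOp (fun f y m => match m with
      | 0 => 0
      | m + 1 => f y m)
    (by
      intro f g h
      filter_upwards [h] with y hy
      simp only [hy])
    (by
      intro f hf
      filter_upwards [hf] with y hy m
      cases m with
      | zero => exact analyticAt_const
      | succ m => exact hy m)
    (by
      intro f g _ _
      refine Eventually.of_forall fun y => ?_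
      funext m
      cases m <;> simp)
    (by
      intro c f _
      refine Eventually.of_forall fun y => ?_
      funext m
      cases m <;> simp)

/-- The derivative `∂/∂x_i` with respect to a coordinate of `Y`, coefficient by coefficient. -/
def derivBase {d : ℕ} (p : Fin d → ℂ) (i : Fin d) : Module.End ℂ (FormalGerm p) :=
  liftOp (fun f y m => fderiv ℂ (fun z => f z m) y (Pi.single i 1))
    (by
      intro f g h
      filter_upwards [h.eventually_nhds] with y hy
      funext m
      have h1 : (fun z => f z m) =ᶠ[𝓝 y] fun z => g z m := by
        filter_upwards [hy] with z hz
        rw [hz]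
      rw [h1.fderiv_eq])
    (by
      intro f hf
      filter_upwards [hf] with y hy m
      exact ((ContinuousLinearMap.apply ℂ ℂ (Pi.single i 1 : Fin d → ℂ)).analyticAt _).comp
        (hy m).fderiv)
    (by
      intro f g hf hg
      filter_upwards [hf, hg] with y h1 h2
      funext m
      have h3 := fderiv_add (h1 m).differentiableAt (h2 m).differentiableAt
      exact congrArg (fun L => L (Pi.single i 1)) h3)
    (by
      intro c f hf
      filter_upwards [hf] with y h1
      funext m
      have h3 := fderiv_const_smul (h1 m).differentiableAt c
      exact congrArg (fun L => L (Pi.single i 1)) h3)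

/-- The derivative `∂/∂t` with respect to the last coordinate. -/
def derivNormal {d : ℕ} (p : Fin d → ℂ) : Module.End ℂ (FormalGerm p) :=
  liftOp (fun f y m => ((m : ℂ) + 1) * f y (m + 1))
    (by
      intro f g h
      filter_upwards [h] with y hy
      simp only [hy])
    (by
      intro f hf
      filter_upwards [hf] with y hy m
      exact analyticAt_const.mul (hy (m + 1)))
    (by
      intro f g _ _
      refine Eventually.of_forall fun y => ?_
      funext m
      simp [mul_add])
    (by
      intro c f _
      refine Eventually.of_forall fun y => ?_
      funext m
      simp only [Pi.smul_apply, smul_eq_mul]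
      ring)

/-- Multiplication by the coordinate `x_i` of `X`. -/
def mulX {d : ℕ} (p : Fin d → ℂ) : Fin (d + 1) → Module.End ℂ (FormalGerm p) :=
  Fin.lastCases (mulNormal p) (mulBase p)

/-- The partial derivative `∂_i = ∂/∂x_i` on `X`. -/
def pderiv {d : ℕ} (p : Fin d → ℂ) : Fin (d + 1) → Module.End ℂ (FormalGerm p) :=
  Fin.lastCases (derivNormal p) (derivBase p)

/-! ### Gevrey series -/

/-- The germs of Gevrey series along `Y` of order at most `s`: the series
`∑ₘ f_m(y) / (m!)^(s-1) tᵐ` converges to a holomorphic function near `(p, 0)`. -/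
def Gevrey {d : ℕ} (p : Fin d → ℂ) (s : ℝ) : Submodule ℂ (FormalGerm p) where
  carrier := {F | ∃ f : (Fin d → ℂ) → ℕ → ℂ, (f : Germ (𝓝 p) (ℕ → ℂ)) = F.1 ∧
    ∃ g : (Fin d → ℂ) × ℂ → ℂ, AnalyticAt ℂ g (p, 0) ∧
      ∀ᶠ z in 𝓝 (p, (0 : ℂ)),
        HasSum (fun m : ℕ => f z.1 m / (((m.factorial : ℝ) ^ (s - 1) : ℝ) : ℂ) * z.2 ^ m) (g z)}
  add_mem' := by
    rintro ⟨F, hF⟩ ⟨G, hG⟩ ⟨f, rfl, u, hu, hfu⟩ ⟨g, rfl, v, hv, hgv⟩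
    refine ⟨f + g, rfl, u + v, hu.add hv, ?_⟩
    filter_upwards [hfu, hgv] with z h1 h2
    have h3 := h1.add h2
    simp only [← add_mul, ← add_div] at h3
    exact h3
  zero_mem' := by
    refine ⟨0, rfl, 0, analyticAt_const, Eventually.of_forall fun z => ?_⟩
    simp
  smul_mem' := by
    rintro c ⟨F, hF⟩ ⟨f, rfl, u, hu, hfu⟩
    refine ⟨c • f, rfl, c • u, analyticAt_const.mul hu, ?_⟩
    filter_upwards [hfu] with z h1
    have h3 := h1.mul_left c
    simp only [← mul_assoc, ← mul_div_assoc] at h3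
    exact h3

/-! ### The hypergeometric system of a row matrix -/

/-- The Weyl algebra `D` of linear differential operators with polynomial coefficients,
through its action on formal series. -/
def Weyl {d : ℕ} (p : Fin d → ℂ) : Subalgebra ℂ (Module.End ℂ (FormalGerm p)) :=
  Algebra.adjoin ℂ (Set.range (mulX p) ∪ Set.range (pderiv p))

/-- The element `x_i` of the Weyl algebra. -/
def Weyl.x {d : ℕ} (p : Fin d → ℂ) (i : Fin (d + 1)) : Weyl p :=
  ⟨mulX p i, Algebra.subset_adjoin (Or.inl ⟨i, rfl⟩)⟩

/-- The element `∂_i` of the Weyl algebra. -/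
def Weyl.del {d : ℕ} (p : Fin d → ℂ) (i : Fin (d + 1)) : Weyl p :=
  ⟨pderiv p i, Algebra.subset_adjoin (Or.inr ⟨i, rfl⟩)⟩

/-- The monomial `∂^u = ∂_0^(u 0) ⋯ ∂_d^(u d)`. -/
def Weyl.delPow {d : ℕ} (p : Fin d → ℂ) (u : Fin (d + 1) → ℕ) : Weyl p :=
  (List.ofFn fun i => Weyl.del p i ^ u i).prod

/-- The hypergeometric ideal `H_A(β)` of the row matrix `A`: the left ideal of `D` generated by
the `∂^u - ∂^v` with `Au = Av` and by `∑ᵢ Aᵢ x_i ∂_i - β`. -/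
def hypIdeal {d : ℕ} (p : Fin d → ℂ) (A : Fin (d + 1) → ℕ) (β : ℂ) : Ideal (Weyl p) :=
  Ideal.span
    ({P | ∃ u v : Fin (d + 1) → ℕ, ∑ i, A i * u i = ∑ i, A i * v i ∧
        P = Weyl.delPow p u - Weyl.delPow p v} ∪
      {(∑ i, (A i : ℂ) • (Weyl.x p i * Weyl.del p i)) - algebraMap ℂ (Weyl p) β})

/-- The stalk at `(p, 0)` of the solutions of `M_A(β) = D / H_A(β)` in Gevrey series of order at
most `s`: a morphism of `D`-modules on `M_A(β)` is given by the image of the class of `1`,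
which is any series annihilated by `H_A(β)`. -/
def Sol {d : ℕ} (p : Fin d → ℂ) (A : Fin (d + 1) → ℕ) (β : ℂ) (s : ℝ) :
    Submodule ℂ (FormalGerm p) where
  carrier := {F | F ∈ Gevrey p s ∧ ∀ P ∈ hypIdeal p A β, P.1 F = 0}
  add_mem' := by
    rintro F G ⟨hF, hF'⟩ ⟨hG, hG'⟩
    exact ⟨add_mem hF hG, fun P hP => by rw [map_add, hF' P hP, hG' P hP, add_zero]⟩
  zero_mem' := ⟨zero_mem _, fun P _ => map_zero _⟩
  smul_mem' := by
    rintro c F ⟨hF, hF'⟩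
    exact ⟨Submodule.smul_mem _ c hF, fun P hP => by rw [map_smul, hF' P hP, smul_zero]⟩

/-! ### Restriction to `x_0 = 0` -/

/-- Restriction of a formal series on `ℂ^(d+2)` to the hyperplane `x_0 = 0`. -/
def restrictZero {d : ℕ} (p : Fin d → ℂ) :
    FormalGerm (Fin.cons 0 p : Fin (d + 1) → ℂ) →ₗ[ℂ] FormalGerm p :=
  have hcont : Continuous fun y : Fin d → ℂ => (Fin.cons 0 y : Fin (d + 1) → ℂ) :=
    continuous_pi fun i => by
      refine Fin.cases ?_ (fun j => ?_) i
      · simpa using continuous_const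
      · simpa using continuous_apply j
  liftOp (fun f y m => f (Fin.cons 0 y) m)
    (by
      intro f g h
      filter_upwards [hcont.continuousAt.eventually h] with y hy
      simp only [hy])
    (by
      intro f hf
      filter_upwards [hcont.continuousAt.eventually hf] with y hy m
      have han : AnalyticAt ℂ (fun y : Fin d → ℂ => (Fin.cons 0 y : Fin (d + 1) → ℂ)) y := by
        rw [analyticAt_pi_iff]
        intro i
        refine Fin.cases ?_ (fun j => ?_) i
        · simpa using analyticAt_const
        · exact (ContinuousLinearMap.proj (R := ℂ) (φ := fun _ : Fin d => ℂ) j).analyticAt y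
      exact (hy m).fun_comp han)
    (fun _ _ _ _ => Eventually.of_forall fun _ => rfl)
    (fun _ _ _ => Eventually.of_forall fun _ => rfl)

/-- The map `φ ↦ (∂^ℓ φ / ∂x_0^ℓ restricted to x_0 = 0)`, `0 ≤ ℓ < k`, on formal series. -/
def varpi {d : ℕ} (k : ℕ) (p : Fin d → ℂ) :
    FormalGerm (Fin.cons 0 p : Fin (d + 1) → ℂ) →ₗ[ℂ] (Fin k → FormalGerm p) :=
  LinearMap.pi fun ℓ =>
    restrictZero p ∘ₗ (pderiv (Fin.cons 0 p : Fin (d + 1) → ℂ) 0 ^ (ℓ : ℕ))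

/-- The direct sum `⊕_{ℓ<k} Sol(M_A((β-ℓ)/k))`, inside the `k`-tuples of formal series. -/
def SolSum {d : ℕ} (k : ℕ) (p : Fin d → ℂ) (A : Fin (d + 1) → ℕ) (β : ℂ) (s : ℝ) :
    Submodule ℂ (Fin k → FormalGerm p) :=
  Submodule.pi Set.univ fun ℓ : Fin k => Sol p A ((β - (ℓ : ℕ)) / k) s

/-! ### The series `ψ` for `A = (a, b)` -/

/-- `L` is a holomorphic branch of the logarithm near `ε`. -/
def IsLogBranch (L : ℂ → ℂ) (ε : ℂ) : Prop :=
  AnalyticAt ℂ L ε ∧ ∀ᶠ x in 𝓝 ε, Complex.exp (L x) = x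

/-- `[z]_n = z (z - 1) ⋯ (z - n + 1)`. -/
def poch (z : ℂ) (n : ℕ) : ℂ := (descPochhammer ℂ n).eval z

/-- Coefficients of
`ψ^(j)_{(a,b),β} = ∑ₘ [(β-jb)/a]_{bm} / [am+j]_{am} · x_1^((β-jb)/a - bm) x_2^(am+j)`
with respect to `x_2`, where `x_1^c = exp(c L(x_1))`. As `j < a`, the exponents `am + j`, `m ≥ 0`,
are the natural numbers `n` with `n % a = j`, and then `m = n / a`. -/
def psiCoeff (a b : ℕ) (β : ℂ) (L : ℂ → ℂ) (j : Fin a) (y : Fin 1 → ℂ) (n : ℕ) : ℂ :=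
  if n % a = j then
    poch ((β - (j : ℕ) * b) / a) (b * (n / a)) /
      poch ((a * (n / a) + j : ℕ) : ℂ) (a * (n / a)) *
      Complex.exp (((β - (j : ℕ) * b) / a - b * (n / a : ℕ)) * L (y 0))
  else 0

theorem psiCoeff_hol (a b : ℕ) (β : ℂ) {L : ℂ → ℂ} {p : Fin 1 → ℂ} (hL : IsLogBranch L (p 0))
    (j : Fin a) : HolAlong p (psiCoeff a b β L j) := by
  have hc : Tendsto (fun y : Fin 1 → ℂ => y 0) (𝓝 p) (𝓝 (p 0)) :=
    (continuous_apply 0).continuousAt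
  filter_upwards [hc.eventually hL.1.eventually_analyticAt] with y hy n
  unfold psiCoeff
  split_ifs
  · refine analyticAt_const.mul (AnalyticAt.cexp' (analyticAt_const.mul ?_))
    exact AnalyticAt.fun_comp hy
      ((ContinuousLinearMap.proj (R := ℂ) (φ := fun _ : Fin 1 => ℂ) 0).analyticAt y)
  · exact analyticAt_const

/-- The germ of `ψ^(j)_{(a,b),β}` at `(p, 0)`, for the branch `L` of the logarithm. -/
def psi (a b : ℕ) (β : ℂ) {L : ℂ → ℂ} {p : Fin 1 → ℂ} (hL : IsLogBranch L (p 0))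
    (j : Fin a) : FormalGerm p :=
  FormalGerm.mk (psiCoeff a b β L j) (psiCoeff_hol a b β hL j)

/-- The semigroup `ℕA = ℕa + ℕb`. -/
def semigroup (a b : ℕ) : AddSubmonoid ℕ := AddSubmonoid.closure {a, b}

/-- `β = j₀ + kah = r₀ + kq₀ + kah` with `0 ≤ j₀ < ka`, `0 ≤ r₀ < k`, and `0 ≤ j₀' < a`,
`b j₀' ≡ q₀ (mod a)`. -/
def IsExceptional (a b k : ℕ) (β : ℂ) (j₀ : ℕ) (r₀ : Fin k) (q₀ : ℕ) (h : ℤ) (j₀' : Fin a) :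
    Prop :=
  j₀ < k * a ∧ β = j₀ + k * a * h ∧ β = (r₀ : ℕ) + k * q₀ + k * a * h ∧ b * j₀' ≡ q₀ [MOD a]

end GevreyGKZ

end

noncomputable section

namespace GevreyGKZ

/-! ### Estimates and convergent power series -/

/-! A solution `φ` for `A'` is determined by its slices `∂_0^l φ` at `x_0 = 0`, `l ≥ 0`. The Euler
equation of `A'` induces on slice `l` the Euler equation of `(a, b)` with parameter `(β-l)/k`, so
slice `l` is `∑ₙ e_{l,n} x_1^((β-l-kbn)/(ka)) x_2ⁿ` with constant `e_{l,n}`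
(`exists_eq_mono_of_euler`). With `D_l = e_{l,0}`, the relation `∂_2 = ∂_0^(kb)` gives `e_{l,n} =
D_{l+kbn}/n!`, and `∂_1 = ∂_0^(ka)` becomes `D_{l+ka} = (β-l)/(ka) · D_l` (`exists_slice_eq_mono`).
Conversely this recurrence forces `|D_n| ≤ M Kⁿ (n!)^(1/(ka))`, which makes the series built from
`D` Gevrey of order `b/a ≤ s` (`exists_mem_Sol_slice`). The solution space is therefore the
`ka`-dimensional space of sequences `D`, with a basis indexed by the residues modulo `ka`.

In the plane a solution is likewise determined by its coefficients of `x_2ⁿ`, `n < a`, and the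
`ψ^(j)` form a basis. Since `gcd(a,b) = 1`, the map `(ℓ, j) ↦ ℓ + kbj` identifies the index set of
the direct sum with the residues modulo `ka`. In these bases `ϖ` is diagonal, with entries `weight
(ka) β (ℓ+kbj) / j!` (`varpi_eq_weight_smul`).

The weight of `l` is the product of `(β-l')/(ka)` over the `l' < l` congruent to `l` modulo `ka`. It
vanishes exactly when `β` is one of these `l'`. For `β = r + kc`, `r < k`, this means `ℓ = r`, `bj ≡
c (mod a)` and `c < bj`; as `j < a`, the congruence turns the inequality into `c ∉ ℕA`
(`lt_mul_iff_notMem_semigroup`). So either no diagonal entry vanishes, or exactly one does: these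
are the two cases of the theorem. -/

theorem exists_bound_of_recurrence {κ b : ℕ} (hκ : 1 ≤ κ) {C : ℝ} {E : ℕ → ℂ}
    (hE : ∀ n, ‖E (n + κ)‖ ≤ C * ((n : ℝ) + 1) ^ b * ‖E n‖) :
    ∃ M K : ℝ, 0 ≤ M ∧ 1 ≤ K ∧
      ∀ n, ‖E n‖ ≤ M * K ^ n * (n.factorial : ℝ) ^ ((b : ℝ) / κ) := by
  have hκ0 : (κ : ℝ) ≠ 0 := by positivity
  refine ⟨∑ i ∈ Finset.range κ, ‖E i‖, max C 1, by positivity, le_max_right _ _, ?_⟩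
  set M := ∑ i ∈ Finset.range κ, ‖E i‖
  set K := max C 1
  have hK1 : 1 ≤ K := le_max_right _ _
  have hM0 : 0 ≤ M := by positivity
  intro n
  induction n using Nat.strong_induction_on with
  | _ n ih =>
    have hfac : (1 : ℝ) ≤ n.factorial := by exact_mod_cast n.factorial_pos
    rcases lt_or_ge n κ with h | h
    · have h1 : ‖E n‖ ≤ M :=
        Finset.single_le_sum (f := fun i => ‖E i‖) (fun i _ => norm_nonneg _)
          (Finset.mem_range.2 h)
      have h2 : 1 ≤ K ^ n := one_le_pow₀ hK1
      have h3 : 1 ≤ (n.factorial : ℝ) ^ ((b : ℝ) / κ) :=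
        Real.one_le_rpow hfac (by positivity)
      calc ‖E n‖ ≤ M * 1 * 1 := by simpa using h1
        _ ≤ _ := by gcongr
    · obtain ⟨m, rfl⟩ : ∃ m, n = m + κ := ⟨n - κ, by omega⟩
      have hm := ih m (by omega)
      have h1 : ((m : ℝ) + 1) ^ b * (m.factorial : ℝ) ^ ((b : ℝ) / κ) ≤
          ((m + κ).factorial : ℝ) ^ ((b : ℝ) / κ) := by
        -- One step of length `κ` costs `(m+1)^b`, the `b/κ`-th power of `(m+1)^κ`, and `m! (m+1)^κ
        -- ≤ (m+κ)!` absorbs it.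
        have h2 : ((m : ℝ) + 1) ^ b = ((((m : ℝ) + 1) ^ κ : ℝ)) ^ ((b : ℝ) / κ) := by
          rw [← Real.rpow_natCast_mul (by positivity), mul_div_cancel₀ _ hκ0, Real.rpow_natCast]
        rw [h2, ← Real.mul_rpow (by positivity) (by positivity)]
        refine Real.rpow_le_rpow (by positivity) ?_ (by positivity)
        rw [mul_comm]
        exact_mod_cast Nat.factorial_mul_pow_le_factorial
      have hC : C ≤ K ^ κ := (le_max_left C 1).trans (le_self_pow₀ hK1 (by omega))
      calc ‖E (m + κ)‖ ≤ C * ((m : ℝ) + 1) ^ b * ‖E m‖ := hE m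
        _ ≤ K ^ κ * ((m : ℝ) + 1) ^ b *
            (M * K ^ m * (m.factorial : ℝ) ^ ((b : ℝ) / κ)) := by gcongr
        _ = M * K ^ (m + κ) *
            (((m : ℝ) + 1) ^ b * (m.factorial : ℝ) ^ ((b : ℝ) / κ)) := by ring
        _ ≤ _ := by gcongr

theorem factorial_add_le_two_pow (i j : ℕ) :
    ((i + j).factorial : ℝ) ≤ 2 ^ (i + j) * i.factorial * j.factorial := by
  rw [← Nat.add_choose_mul_factorial_mul_factorial i j]
  push_cast
  gcongr
  exact_mod_cast Nat.choose_le_two_pow (i + j) _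

theorem factorial_mul_le_pow (m n : ℕ) :
    ((m * n).factorial : ℝ) ≤ (m : ℝ) ^ (m * n) * (n.factorial : ℝ) ^ m := by
  induction n with
  | zero => simp
  | succ n ih =>
    have h1 : (m * n + m).factorial ≤ (m * n).factorial * (m * n + m) ^ m := by
      rw [← Nat.factorial_mul_ascFactorial]
      gcongr
      exact Nat.ascFactorial_le_pow_add _ _
    calc ((m * (n + 1)).factorial : ℝ) ≤ (m * n).factorial * (m * n + m : ℝ) ^ m := by
          rw [mul_add_one]; exact_mod_cast h1
      _ ≤ ((m : ℝ) ^ (m * n) * (n.factorial : ℝ) ^ m) * (m * n + m : ℝ) ^ m := by gcongr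
      _ = _ := by
          rw [Nat.factorial_succ, show (m * n + m : ℝ) = m * (n + 1) by ring, mul_pow, mul_add_one,
            pow_add, Nat.cast_mul, mul_pow]
          push_cast
          ring

/-- The Taylor series at `0` of the `N`-th derivative of `∑ D_i uⁱ / i!`. -/
def expGen (D : ℕ → ℂ) (N : ℕ) (u : ℂ) : ℂ :=
  ∑' i : ℕ, D (i + N) / i.factorial * u ^ i

theorem expGen_zero (D : ℕ → ℂ) (N : ℕ) : expGen D N 0 = D N := by
  rw [expGen, tsum_eq_single 0]
  · simp
  · intro i hi
    simp [hi]

theorem norm_shift_div_factorial_le {D : ℕ → ℂ} {M K : ℝ} (hM : 0 ≤ M) (hK : 1 ≤ K)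
    (hD : ∀ n, ‖D n‖ ≤ M * K ^ n * n.factorial) (N i : ℕ) :
    ‖D (i + N) / i.factorial‖ ≤ M * (2 * K) ^ N * N.factorial * (2 * K) ^ i := by
  rw [norm_div, Complex.norm_natCast, div_le_iff₀ (by positivity)]
  calc ‖D (i + N)‖ ≤ M * K ^ (i + N) * (2 ^ (i + N) * i.factorial * N.factorial) := by
        refine (hD _).trans ?_
        gcongr
        exact factorial_add_le_two_pow i N
    _ = _ := by ring

theorem summable_expGen {D : ℕ → ℂ} {M K : ℝ} (hM : 0 ≤ M) (hK : 1 ≤ K)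
    (hD : ∀ n, ‖D n‖ ≤ M * K ^ n * n.factorial) (N : ℕ) {r : ℝ} (hr0 : 0 ≤ r)
    (hr : 2 * K * r < 1) : Summable fun i => ‖D (i + N) / i.factorial‖ * r ^ i := by
  refine Summable.of_nonneg_of_le (fun i => by positivity) (fun i => ?_)
    ((summable_geometric_of_lt_one (by positivity) hr).mul_left (M * (2 * K) ^ N * N.factorial))
  rw [mul_pow (2 * K) r i, ← mul_assoc]
  refine mul_le_mul_of_nonneg_right ?_ (by positivity)
  exact norm_shift_div_factorial_le hM hK hD N i

/-- Termwise differentiation shifts `D` by one. The coefficients are `O((2K)ⁱ)`, so on the disc of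
radius `1/(4K)` the differentiated series is dominated by a geometric series of ratio `1/2`. -/
theorem hasDerivAt_expGen {D : ℕ → ℂ} {M K : ℝ} (hM : 0 ≤ M) (hK : 1 ≤ K)
    (hD : ∀ n, ‖D n‖ ≤ M * K ^ n * n.factorial) (N : ℕ) {u : ℂ}
    (hu : ‖u‖ < 1 / (4 * K)) : HasDerivAt (expGen D N) (expGen D (N + 1) u) u := by
  have hK0 : 0 < K := by linarith
  set r := 1 / (4 * K) with hrdef
  have hr0 : 0 ≤ r := by positivity
  have hr : 2 * K * r < 1 := by
    rw [hrdef]; field_simp; norm_num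
  have key : ∀ (i : ℕ), D (i + 1 + N) / (i + 1).factorial * (((i + 1 : ℕ) : ℂ)) =
      D (i + (N + 1)) / i.factorial := by
    intro i
    rw [Nat.factorial_succ, show i + 1 + N = i + (N + 1) by ring]
    have : ((i + 1 : ℕ) : ℂ) ≠ 0 := by exact_mod_cast i.succ_ne_zero
    have : (i.factorial : ℂ) ≠ 0 := by exact_mod_cast i.factorial_ne_zero
    push_cast at *
    field_simp
  have h1 : HasDerivAt (expGen D N)
      (∑' i : ℕ, D (i + N) / i.factorial * ((i : ℂ) * u ^ (i - 1))) u := by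
    refine hasDerivAt_tsum_of_isPreconnected
      (u := fun i : ℕ => ‖D (i + N) / i.factorial‖ * (i * r ^ (i - 1)))
      (g := fun i u => D (i + N) / i.factorial * u ^ i)
      (g' := fun i u => D (i + N) / i.factorial * ((i : ℂ) * u ^ (i - 1)))
      (t := Metric.ball 0 r) (y₀ := 0) ?_ Metric.isOpen_ball
      (convex_ball _ _).isPreconnected (fun i y _ => (hasDerivAt_pow i y).const_mul _) ?_ ?_ ?_ ?_
    · rw [← summable_nat_add_iff 1]
      refine (summable_expGen hM hK hD (N + 1) hr0 hr).congr fun i => ?_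
      rw [← key i, norm_mul, Complex.norm_natCast]
      simp [mul_assoc]
    · intro i y hy
      rw [norm_mul, norm_mul, Complex.norm_natCast, norm_pow]
      have : ‖y‖ ≤ r := by simpa using (mem_ball_zero_iff.1 hy).le
      gcongr
    · simpa using lt_of_le_of_lt (norm_nonneg _) hu
    · refine summable_of_ne_finset_zero (s := {0}) fun i hi => ?_
      simp only [Finset.mem_singleton] at hi
      simp [hi]
    · simpa using hu
  convert h1 using 1
  have hsum : Summable fun i : ℕ => D (i + N) / i.factorial * ((i : ℂ) * u ^ (i - 1)) := by
    rw [← summable_nat_add_iff 1]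
    refine Summable.of_norm_bounded (summable_expGen hM hK hD (N + 1) hr0 hr) fun i => ?_
    rw [← mul_assoc, key i, norm_mul, norm_pow]
    simp only [Nat.add_sub_cancel]
    gcongr
  rw [hsum.tsum_eq_zero_add]
  simp only [Nat.cast_zero, zero_mul, mul_zero, zero_add, Nat.add_sub_cancel, ← mul_assoc, key]
  rfl

theorem analyticAt_expGen {D : ℕ → ℂ} {M K : ℝ} (hM : 0 ≤ M) (hK : 1 ≤ K)
    (hD : ∀ n, ‖D n‖ ≤ M * K ^ n * n.factorial) (N : ℕ) {u : ℂ}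
    (hu : ‖u‖ < 1 / (4 * K)) : AnalyticAt ℂ (expGen D N) u := by
  have h1 : DifferentiableOn ℂ (expGen D N) (Metric.ball 0 (1 / (4 * K))) := fun v hv =>
    (hasDerivAt_expGen hM hK hD N (mem_ball_zero_iff.1 hv)).differentiableAt.differentiableWithinAt
  exact h1.analyticAt (Metric.isOpen_ball.mem_nhds (mem_ball_zero_iff.2 hu))

/-- The homogeneous part of degree `m` of `∑ c_{i,j} uⁱ vʲ`, as a multilinear map. -/
def twoVarSeries (c : ℕ → ℕ → ℂ) : FormalMultilinearSeries ℂ (ℂ × ℂ) ℂ := fun m =>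
  ∑ q ∈ Finset.HasAntidiagonal.antidiagonal m, c q.1 q.2 •
    (ContinuousMultilinearMap.mkPiAlgebraFin ℂ m ℂ).compContinuousLinearMap
      (fun t : Fin m => if (t : ℕ) < q.1 then ContinuousLinearMap.fst ℂ ℂ ℂ
        else ContinuousLinearMap.snd ℂ ℂ ℂ)

theorem twoVarSeries_apply (c : ℕ → ℕ → ℂ) (m : ℕ) (u v : ℂ) :
    twoVarSeries c m (fun _ => (u, v)) =
      ∑ q ∈ Finset.HasAntidiagonal.antidiagonal m, c q.1 q.2 * u ^ q.1 * v ^ q.2 := by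
  rw [twoVarSeries, sum_apply]
  refine Finset.sum_congr rfl fun q hq => ?_
  obtain ⟨i, j⟩ := q
  obtain rfl : i + j = m := Finset.HasAntidiagonal.mem_antidiagonal.1 hq
  simp only [smul_apply,
    ContinuousMultilinearMap.compContinuousLinearMap_apply,
    ContinuousMultilinearMap.mkPiAlgebraFin_apply, List.prod_ofFn, Fin.prod_univ_add, smul_eq_mul,
    mul_assoc]
  simp

theorem norm_twoVarSeries_le {c : ℕ → ℕ → ℂ} {M K : ℝ}
    (hc : ∀ i j, ‖c i j‖ ≤ M * K ^ (i + j)) (hM : 0 ≤ M) (hK : 0 ≤ K) (m : ℕ) :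
    ‖twoVarSeries c m‖ ≤ M * (2 * K) ^ m := by
  have h1 : ∀ q ∈ Finset.HasAntidiagonal.antidiagonal m, ‖c q.1 q.2 •
      (ContinuousMultilinearMap.mkPiAlgebraFin ℂ m ℂ).compContinuousLinearMap
      (fun t : Fin m => if (t : ℕ) < q.1 then ContinuousLinearMap.fst ℂ ℂ ℂ
        else ContinuousLinearMap.snd ℂ ℂ ℂ)‖ ≤ M * K ^ m := by
    intro q hq
    have hq' := Finset.HasAntidiagonal.mem_antidiagonal.1 hq
    rw [norm_smul]
    have h2 : ‖(ContinuousMultilinearMap.mkPiAlgebraFin ℂ m ℂ).compContinuousLinearMap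
      (fun t : Fin m => if (t : ℕ) < q.1 then ContinuousLinearMap.fst ℂ ℂ ℂ
        else ContinuousLinearMap.snd ℂ ℂ ℂ)‖ ≤ 1 := by
      refine (ContinuousMultilinearMap.norm_compContinuousLinearMap_le _ _).trans ?_
      rw [ContinuousMultilinearMap.norm_mkPiAlgebraFin, one_mul]
      refine Finset.prod_le_one (fun _ _ => norm_nonneg _) fun t _ => ?_
      split_ifs
      · exact ContinuousLinearMap.norm_fst_le ..
      · exact ContinuousLinearMap.norm_snd_le ..
    calc _ ≤ M * K ^ (q.1 + q.2) * 1 := by gcongr; exact hc _ _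
      _ = _ := by rw [hq', mul_one]
  refine (norm_sum_le_of_le _ h1).trans ?_
  rw [Finset.sum_const, Finset.Nat.card_antidiagonal, nsmul_eq_mul, mul_pow]
  -- There are `m + 1` monomials of degree `m`; this is the source of the factor `2` in `2K`.
  have : ((m + 1 : ℕ) : ℝ) ≤ 2 ^ m := by exact_mod_cast Nat.lt_two_pow_self (n := m)
  calc ((m + 1 : ℕ) : ℝ) * (M * K ^ m) ≤ 2 ^ m * (M * K ^ m) := by gcongr
    _ = _ := by ring

/-- The double series converges absolutely. Grouped by total degree it is the sum of a formal
multilinear series, hence analytic; grouped by powers of `v` it has the shape required in the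
definition of Gevrey series. -/
theorem exists_analyticAt_hasSum {c : ℕ → ℕ → ℂ} {M K : ℝ}
    (hc : ∀ i j, ‖c i j‖ ≤ M * K ^ (i + j)) (hM : 0 ≤ M) (hK : 0 < K) :
    ∃ G : ℂ × ℂ → ℂ, AnalyticAt ℂ G (0, 0) ∧ ∀ u v : ℂ, ‖u‖ < 1 / (2 * K) → ‖v‖ < 1 / (2 * K) →
      HasSum (fun n => (∑' i, c i n * u ^ i) * v ^ n) (G (u, v)) := by
  set r : NNReal := ⟨1 / (2 * K), by positivity⟩ with hr
  have hrad : (r : ENNReal) ≤ (twoVarSeries c).radius := by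
    refine (twoVarSeries c).le_radius_of_bound M fun m => ?_
    calc ‖twoVarSeries c m‖ * (r : ℝ) ^ m ≤ M * (2 * K) ^ m * (1 / (2 * K)) ^ m := by
          gcongr
          · exact norm_twoVarSeries_le hc hM hK.le m
          · exact le_rfl
      _ = M := by rw [mul_assoc, ← mul_pow, mul_one_div_cancel (by positivity), one_pow, mul_one]
  have hr0 : 0 < r := by
    rw [← NNReal.coe_pos]; change 0 < 1 / (2 * K); positivity
  have hball := (twoVarSeries c).hasFPowerSeriesOnBall
    (lt_of_lt_of_le (by exact_mod_cast hr0) hrad)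
  refine ⟨(twoVarSeries c).sum, hball.analyticAt, fun u v hu hv => ?_⟩
  have hKu : K * ‖u‖ < 1 := by
    rw [lt_div_iff₀ (by positivity)] at hu; nlinarith [norm_nonneg u]
  have hKv : K * ‖v‖ < 1 := by
    rw [lt_div_iff₀ (by positivity)] at hv; nlinarith [norm_nonneg v]
  have hs : Summable fun q : ℕ × ℕ => c q.1 q.2 * u ^ q.1 * v ^ q.2 := by
    refine Summable.of_norm_bounded (g := fun q : ℕ × ℕ =>
      M * ((K * ‖u‖) ^ q.1 * (K * ‖v‖) ^ q.2)) ?_ fun q => ?_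
    · exact ((summable_geometric_of_lt_one (by positivity) hKu).mul_of_nonneg
        (summable_geometric_of_lt_one (by positivity) hKv) (fun _ => by positivity)
        (fun _ => by positivity)).mul_left M
    · rw [norm_mul, norm_mul, norm_pow, norm_pow]
      calc _ ≤ M * K ^ (q.1 + q.2) * ‖u‖ ^ q.1 * ‖v‖ ^ q.2 := by gcongr; exact hc _ _
        _ = _ := by rw [mul_pow, mul_pow, pow_add]; ring
  have hG : (twoVarSeries c).sum (u, v) = ∑' q : ℕ × ℕ, c q.1 q.2 * u ^ q.1 * v ^ q.2 := by
    have h1 := (Finset.HasAntidiagonal.sigmaAntidiagonalEquivProd (A := ℕ)).hasSum_iff.2 hs.hasSum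
    have h2 := h1.sigma fun m => (Finset.hasSum (Finset.HasAntidiagonal.antidiagonal m)
      (fun q : ℕ × ℕ => c q.1 q.2 * u ^ q.1 * v ^ q.2))
    refine HasSum.unique ?_ h2
    have h3 := hball.hasSum (y := (u, v)) (by
      refine Metric.eball_subset_eball hrad ?_
      rw [Metric.eball_coe, mem_ball_zero_iff]
      exact max_lt hu hv)
    rw [zero_add] at h3
    simpa only [twoVarSeries_apply] using h3
  rw [hG]
  have h4 := (Equiv.prodComm ℕ ℕ).hasSum_iff.2 hs.hasSum
  have h5 := h4.prod_fiberwise (g := fun n => (∑' i, c i n * u ^ i) * v ^ n) fun n => by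
    have h6 : Summable fun i : ℕ => c i n * u ^ i := by
      refine Summable.of_norm_bounded (g := fun i : ℕ => M * K ^ n * (K * ‖u‖) ^ i)
        ((summable_geometric_of_lt_one (by positivity) hKu).mul_left _) fun i => ?_
      rw [norm_mul, norm_pow]
      calc _ ≤ M * K ^ (i + n) * ‖u‖ ^ i := by gcongr; exact hc _ _
        _ = _ := by rw [mul_pow, pow_add]; ring
    exact h6.hasSum.mul_right (v ^ n)
  exact h5

/-! ### Operators on formal germs -/

theorem FormalGerm.mk_eq_zero {d : ℕ} {p : Fin d → ℂ} {f : (Fin d → ℂ) → ℕ → ℂ}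
    (hf : HolAlong p f) : FormalGerm.mk f hf = 0 ↔ f =ᶠ[𝓝 p] 0 :=
  FormalGerm.mk_eq_mk hf (g := 0) (Eventually.of_forall fun _ _ => analyticAt_const)

theorem analyticAt_coord {d : ℕ} (i : Fin d) (y : Fin d → ℂ) :
    AnalyticAt ℂ (fun z : Fin d → ℂ => z i) y :=
  (ContinuousLinearMap.proj (R := ℂ) (φ := fun _ : Fin d => ℂ) i).analyticAt y

theorem AnalyticAt.fderiv_apply_const {d : ℕ} {u : (Fin d → ℂ) → ℂ} {y : Fin d → ℂ}
    (hu : AnalyticAt ℂ u y) (v : Fin d → ℂ) : AnalyticAt ℂ (fun z => fderiv ℂ u z v) y :=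
  ((ContinuousLinearMap.apply ℂ ℂ v).analyticAt _).comp hu.fderiv

theorem fderiv_fderiv_comm {d : ℕ} {u : (Fin d → ℂ) → ℂ} {y : Fin d → ℂ}
    (hu : AnalyticAt ℂ u y) (v w : Fin d → ℂ) :
    fderiv ℂ (fun z => fderiv ℂ u z v) y w = fderiv ℂ (fun z => fderiv ℂ u z w) y v := by
  have h1 : ∀ v w : Fin d → ℂ,
      fderiv ℂ (fun z => fderiv ℂ u z v) y w = fderiv ℂ (fderiv ℂ u) y w v := by
    intro v w
    have h2 := ((ContinuousLinearMap.apply ℂ ℂ v).hasFDerivAt).comp y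
      hu.fderiv.differentiableAt.hasFDerivAt
    exact congrArg (fun L => L w) h2.fderiv
  rw [h1, h1]
  exact (hu.contDiffAt.isSymmSndFDerivAt_of_omega) w v

theorem commute_derivBase {d : ℕ} (p : Fin d → ℂ) (i j : Fin d) :
    Commute (derivBase p i) (derivBase p j) := by
  refine LinearMap.ext fun F => ?_
  obtain ⟨f, hf, rfl⟩ := F.exists_mk
  refine Subtype.ext (Germ.coe_eq.2 ?_)
  filter_upwards [hf] with y hy
  funext m
  exact fderiv_fderiv_comm (hy m) _ _

theorem commute_derivBase_derivNormal {d : ℕ} (p : Fin d → ℂ) (i : Fin d) :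
    Commute (derivBase p i) (derivNormal p) := by
  refine LinearMap.ext fun F => ?_
  obtain ⟨f, hf, rfl⟩ := F.exists_mk
  refine Subtype.ext (Germ.coe_eq.2 ?_)
  filter_upwards [hf] with y hy
  funext m
  exact congrArg (fun L => L (Pi.single i 1))
    (fderiv_const_mul (hy (m + 1)).differentiableAt ((m : ℂ) + 1))

theorem commute_derivBase_mulNormal {d : ℕ} (p : Fin d → ℂ) (i : Fin d) :
    Commute (derivBase p i) (mulNormal p) := by
  refine LinearMap.ext fun F => ?_
  obtain ⟨f, hf, rfl⟩ := F.exists_mk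
  refine Subtype.ext (Germ.coe_eq.2 ?_)
  refine (Eventually.of_forall fun y => ?_)
  funext m
  cases m with
  | zero => simp
  | succ m => rfl

theorem derivBase_mulBase {d : ℕ} (p : Fin d → ℂ) (i j : Fin d) (F : FormalGerm p) :
    derivBase p i (mulBase p j F) =
      (Pi.single i 1 : Fin d → ℂ) j • F + mulBase p j (derivBase p i F) := by
  obtain ⟨f, hf, rfl⟩ := F.exists_mk
  refine Subtype.ext (Germ.coe_eq.2 ?_)
  filter_upwards [hf] with y hy
  funext m
  have h1 := ((ContinuousLinearMap.proj (R := ℂ) (φ := fun _ : Fin d => ℂ) j).hasFDerivAt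
    (x := y)).mul (hy m).differentiableAt.hasFDerivAt
  have h2 := congrArg (fun L => L (Pi.single i 1)) h1.fderiv
  refine h2.trans ?_
  simp [mul_comm, add_comm]

theorem commute_derivBase_mulBase {d : ℕ} (p : Fin d → ℂ) {i j : Fin d} (h : j ≠ i) :
    Commute (derivBase p i) (mulBase p j) := by
  refine LinearMap.ext fun F => ?_
  have := derivBase_mulBase p i j F
  rw [Pi.single_eq_of_ne h, zero_smul, zero_add] at this
  exact this

/-! ### Restriction -/

/-- The inclusion of `{x_0 = 0}`. -/
def consZero (d : ℕ) : (Fin d → ℂ) →L[ℂ] (Fin (d + 1) → ℂ) :=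
  ContinuousLinearMap.pi (Fin.cons 0 fun j => ContinuousLinearMap.proj j)

theorem consZero_apply {d : ℕ} (y : Fin d → ℂ) : consZero d y = Fin.cons 0 y := by
  funext i
  refine Fin.cases ?_ (fun j => ?_) i <;> simp [consZero]

theorem tendsto_cons_zero {d : ℕ} (p : Fin d → ℂ) :
    Tendsto (fun y : Fin d → ℂ => (Fin.cons 0 y : Fin (d + 1) → ℂ)) (𝓝 p)
      (𝓝 (Fin.cons 0 p)) := by
  have h := (consZero d).continuous.tendsto p
  rw [consZero_apply] at h
  exact h.congr consZero_apply

theorem restrictZero_derivBase_succ {d : ℕ} (p : Fin d → ℂ) (i : Fin d)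
    (F : FormalGerm (Fin.cons 0 p : Fin (d + 1) → ℂ)) :
    restrictZero p (derivBase _ i.succ F) = derivBase p i (restrictZero p F) := by
  obtain ⟨f, hf, rfl⟩ := F.exists_mk
  refine Subtype.ext (Germ.coe_eq.2 ?_)
  filter_upwards [(tendsto_cons_zero p).eventually hf] with y hy
  funext m
  have hd : HasFDerivAt (fun z => f z m) (fderiv ℂ (fun z => f z m) (Fin.cons 0 y))
      (consZero d y) := by
    rw [consZero_apply]; exact (hy m).differentiableAt.hasFDerivAt
  have h1 := hd.comp y (consZero d).hasFDerivAt
  have h2 : ((fun z => f z m) ∘ consZero d) = fun z => f (Fin.cons 0 z) m := by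
    funext z; simp [consZero_apply]
  rw [h2] at h1
  change fderiv ℂ (fun z => f z m) (Fin.cons 0 y) (Pi.single i.succ 1) =
    fderiv ℂ (fun z => f (Fin.cons 0 z) m) y (Pi.single i 1)
  rw [h1.fderiv, ContinuousLinearMap.comp_apply, consZero_apply]
  congr 1
  funext j
  refine Fin.cases ?_ (fun j => ?_) j
  · simp
  · simp [Pi.single_apply, Fin.succ_inj]

theorem restrictZero_derivNormal {d : ℕ} (p : Fin d → ℂ)
    (F : FormalGerm (Fin.cons 0 p : Fin (d + 1) → ℂ)) :
    restrictZero p (derivNormal _ F) = derivNormal p (restrictZero p F) := by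
  obtain ⟨f, hf, rfl⟩ := F.exists_mk
  rfl

theorem restrictZero_mulNormal {d : ℕ} (p : Fin d → ℂ)
    (F : FormalGerm (Fin.cons 0 p : Fin (d + 1) → ℂ)) :
    restrictZero p (mulNormal _ F) = mulNormal p (restrictZero p F) := by
  obtain ⟨f, hf, rfl⟩ := F.exists_mk
  refine Subtype.ext (Germ.coe_eq.2 ?_)
  refine (Eventually.of_forall fun y => ?_)
  funext m
  cases m <;> rfl

theorem restrictZero_mulBase_zero {d : ℕ} (p : Fin d → ℂ)
    (F : FormalGerm (Fin.cons 0 p : Fin (d + 1) → ℂ)) :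
    restrictZero p (mulBase _ 0 F) = 0 := by
  obtain ⟨f, hf, rfl⟩ := F.exists_mk
  refine Subtype.ext ((Germ.coe_eq (g := 0)).2 ?_)
  refine (Eventually.of_forall fun y => ?_)
  funext m
  simp

theorem restrictZero_mulBase_succ {d : ℕ} (p : Fin d → ℂ) (i : Fin d)
    (F : FormalGerm (Fin.cons 0 p : Fin (d + 1) → ℂ)) :
    restrictZero p (mulBase _ i.succ F) = mulBase p i (restrictZero p F) := by
  obtain ⟨f, hf, rfl⟩ := F.exists_mk
  refine Subtype.ext (Germ.coe_eq.2 ?_)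
  refine (Eventually.of_forall fun y => ?_)
  funext m
  simp

/-- The `l`-fold iterate of the derivative in the direction `v`. -/
def iterDir {d : ℕ} (v : Fin d → ℂ) (u : (Fin d → ℂ) → ℂ) : ℕ → (Fin d → ℂ) → ℂ
  | 0 => u
  | l + 1 => fun y => fderiv ℂ (iterDir v u l) y v

theorem analyticAt_iterDir {d : ℕ} (v : Fin d → ℂ) {u : (Fin d → ℂ) → ℂ} {y : Fin d → ℂ}
    (hu : AnalyticAt ℂ u y) (l : ℕ) : AnalyticAt ℂ (iterDir v u l) y := by
  induction l with
  | zero => exact hu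
  | succ l ih => exact AnalyticAt.fderiv_apply_const ih v

theorem derivBase_pow_mk {d : ℕ} (p : Fin d → ℂ) (i : Fin d) {f : (Fin d → ℂ) → ℕ → ℂ}
    (hf : HolAlong p f) (l : ℕ) :
    ∃ h, (derivBase p i ^ l) (FormalGerm.mk f hf) =
      FormalGerm.mk (fun y m => iterDir (Pi.single i 1) (fun z => f z m) l y) h := by
  induction l with
  | zero => exact ⟨hf, rfl⟩
  | succ l ih =>
    obtain ⟨h, hl⟩ := ih
    refine ⟨?_, ?_⟩
    · filter_upwards [hf] with y hy m
      exact analyticAt_iterDir _ (hy m) _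
    · rw [pow_succ', Module.End.mul_apply, hl]
      rfl

theorem hasDerivAt_iterDir_cons {d : ℕ} {u : (Fin (d + 1) → ℂ) → ℂ} {y : Fin d → ℂ} {t : ℂ}
    (hu : AnalyticAt ℂ u (Fin.cons t y)) (l : ℕ) :
    HasDerivAt (fun t => iterDir (Pi.single 0 1) u l (Fin.cons t y))
      (iterDir (Pi.single 0 1) u (l + 1) (Fin.cons t y)) t := by
  have h1 : HasDerivAt (fun t : ℂ => (Fin.cons t y : Fin (d + 1) → ℂ)) (Pi.single 0 1) t := by
    rw [hasDerivAt_pi]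
    intro i
    refine Fin.cases ?_ (fun j => ?_) i
    · simpa using hasDerivAt_id' t
    · simpa using hasDerivAt_const t (y j)
  exact (analyticAt_iterDir (Pi.single 0 1) hu l).differentiableAt.hasFDerivAt.comp_hasDerivAt t h1

/-- Each coefficient equals its Taylor series in `x_0`, so a germ is determined by its slices.
Equations in the larger space can thus be checked slice by slice. -/
theorem eq_zero_of_restrictZero_derivBase_pow {d : ℕ} {p : Fin d → ℂ}
    {F : FormalGerm (Fin.cons 0 p : Fin (d + 1) → ℂ)}
    (hF : ∀ l, restrictZero p ((derivBase _ 0 ^ l) F) = 0) : F = 0 := by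
  obtain ⟨f, hf, rfl⟩ := F.exists_mk
  obtain ⟨r, hr, hball⟩ := Metric.eventually_nhds_iff_ball.1 hf
  refine (FormalGerm.mk_eq_zero hf).2 ?_
  filter_upwards [Metric.ball_mem_nhds _ hr] with y hy
  funext m
  have hcons : ∀ t : ℂ, ∀ z : Fin d → ℂ, t ∈ Metric.ball (0 : ℂ) r → z ∈ Metric.ball p r →
      (Fin.cons t z : Fin (d + 1) → ℂ) ∈ Metric.ball (Fin.cons 0 p : Fin (d + 1) → ℂ) r := by
    intro t z ht hz
    rw [Metric.mem_ball, dist_pi_lt_iff hr]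
    intro i
    refine Fin.cases ?_ (fun j => ?_) i
    · simpa using ht
    · simpa using (dist_le_pi_dist z p j).trans_lt hz
  set u := fun z => f z m
  -- The neighbourhood on which the `l`-th slice is known to vanish may shrink with `l`; the
  -- identity theorem extends the vanishing to one ball valid for all `l`.
  have hzero : ∀ l, ∀ z ∈ Metric.ball p r, iterDir (Pi.single 0 1) u l (Fin.cons 0 z) = 0 := by
    intro l
    have han : AnalyticOnNhd ℂ (fun z => iterDir (Pi.single 0 1) u l (Fin.cons 0 z))
        (Metric.ball p r) := by
      intro z hz
      have h1 := analyticAt_iterDir (Pi.single 0 1)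
        (hball _ (hcons 0 z (Metric.mem_ball_self hr) hz) m) l
      rw [← consZero_apply] at h1
      simpa only [Function.comp_def, consZero_apply] using h1.comp ((consZero d).analyticAt z)
    refine han.eqOn_zero_of_preconnected_of_eventuallyEq_zero
      (convex_ball _ _).isPreconnected (Metric.mem_ball_self hr) ?_
    obtain ⟨h, hl⟩ := derivBase_pow_mk (Fin.cons 0 p : Fin (d + 1) → ℂ) 0 hf l
    have h2 := hF l
    rw [hl] at h2
    filter_upwards [(Germ.coe_eq (g := 0)).1 (congrArg Subtype.val h2)] with z hz
    exact congrFun hz m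
  obtain ⟨hy0, hyt⟩ : y 0 ∈ Metric.ball (0 : ℂ) r ∧ Fin.tail y ∈ Metric.ball p r := by
    rw [Metric.mem_ball, dist_pi_lt_iff hr] at hy
    refine ⟨by simpa using hy 0, ?_⟩
    rw [Metric.mem_ball, dist_pi_lt_iff hr]
    intro j
    simpa [Fin.tail] using hy j.succ
  have hder : ∀ l, ∀ t ∈ Metric.ball (0 : ℂ) r,
      iteratedDeriv l (fun t => u (Fin.cons t (Fin.tail y))) t =
        iterDir (Pi.single 0 1) u l (Fin.cons t (Fin.tail y)) := by
    intro l
    induction l with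
    | zero => intro t _; simp [iterDir]
    | succ l ih =>
      intro t ht
      rw [iteratedDeriv_succ]
      have h1 : iteratedDeriv l (fun t => u (Fin.cons t (Fin.tail y))) =ᶠ[𝓝 t]
          fun t => iterDir (Pi.single 0 1) u l (Fin.cons t (Fin.tail y)) := by
        filter_upwards [Metric.isOpen_ball.mem_nhds ht] with t' ht'
        exact ih t' ht'
      rw [h1.deriv_eq]
      exact (hasDerivAt_iterDir_cons (hball _ (hcons t _ ht hyt) m) l).deriv
  have hdiff : DifferentiableOn ℂ (fun t => u (Fin.cons t (Fin.tail y))) (Metric.ball 0 r) :=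
    fun t ht => (hasDerivAt_iterDir_cons (hball _ (hcons t _ ht hyt) m)
      0).differentiableAt.differentiableWithinAt
  have h3 := Complex.taylorSeries_eq_on_ball' hy0 hdiff
  simp only [hder _ 0 (Metric.mem_ball_self hr), hzero _ _ hyt, mul_zero, zero_mul, tsum_zero] at h3
  rw [Fin.cons_self_tail] at h3
  exact h3.symm

/-! ### Solutions of the hypergeometric system -/

theorem coe_delPow {d : ℕ} (p : Fin d → ℂ) (u : Fin (d + 1) → ℕ) :
    (Weyl.delPow p u : Module.End ℂ (FormalGerm p)) =
      (List.ofFn fun i => pderiv p i ^ u i).prod := by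
  have h := map_list_prod (Weyl p).val (List.ofFn fun i => Weyl.del p i ^ u i)
  rw [List.map_ofFn] at h
  exact h

/-- The operators annihilating `F` form a left ideal, so it suffices to test the generators of
`hypIdeal`. -/
theorem mem_Sol_iff {d : ℕ} {p : Fin d → ℂ} {A : Fin (d + 1) → ℕ} {β : ℂ} {s : ℝ}
    {F : FormalGerm p} : F ∈ Sol p A β s ↔ F ∈ Gevrey p s ∧
      (∀ u v : Fin (d + 1) → ℕ, ∑ i, A i * u i = ∑ i, A i * v i →
        (List.ofFn fun i => pderiv p i ^ u i).prod F =
          (List.ofFn fun i => pderiv p i ^ v i).prod F) ∧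
      ∑ i, (A i : ℂ) • mulX p i (pderiv p i F) = β • F := by
  have hE : ((((∑ i, (A i : ℂ) • (Weyl.x p i * Weyl.del p i)) - algebraMap ℂ (Weyl p) β :
      Weyl p) : Module.End ℂ (FormalGerm p))) F =
      ∑ i, (A i : ℂ) • mulX p i (pderiv p i F) - β • F := by
    have h1 : ((((∑ i, (A i : ℂ) • (Weyl.x p i * Weyl.del p i)) - algebraMap ℂ (Weyl p) β :
      Weyl p) : Module.End ℂ (FormalGerm p))) =
      ∑ i, (A i : ℂ) • (mulX p i * pderiv p i) - algebraMap ℂ _ β := by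
      have h2 := map_sum (Weyl p).val (fun i => (A i : ℂ) • (Weyl.x p i * Weyl.del p i))
        Finset.univ
      exact congrArg (· - _) h2
    rw [h1]
    simp [LinearMap.sum_apply, Module.algebraMap_end_apply]
  refine and_congr_right fun _ => ⟨fun h => ⟨fun u v huv => ?_, ?_⟩, fun ⟨h1, h2⟩ P hP => ?_⟩
  · have h1 := h _ (Ideal.subset_span (Or.inl ⟨u, v, huv, rfl⟩))
    rw [← coe_delPow, ← coe_delPow]
    exact sub_eq_zero.1 h1
  · have h1 := h _ (Ideal.subset_span (Or.inr rfl))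
    exact sub_eq_zero.1 (hE.symm.trans h1)
  · refine Submodule.span_induction (R := Weyl p) (M := Weyl p) (p := fun P _ => P.1 F = 0)
      ?_ ?_ ?_ ?_ hP
    · rintro P (⟨u, v, huv, rfl⟩ | rfl)
      · have h3 := h1 u v huv
        rw [← coe_delPow, ← coe_delPow] at h3
        exact sub_eq_zero.2 h3
      · exact hE.trans (sub_eq_zero.2 h2)
    · rfl
    · intro P Q _ _ hP hQ
      change P.1 F + Q.1 F = 0
      rw [hP, hQ, add_zero]
    · intro Q P _ hP
      change Q.1 (P.1 F) = 0
      rw [hP, map_zero]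

theorem pow_apply_eq_pow_apply {V : Type*} [AddCommGroup V] [Module ℂ V] {P Q : Module.End ℂ V}
    (hPQ : Commute P Q) {F : V} (h : P F = Q F) (t : ℕ) : (P ^ t) F = (Q ^ t) F := by
  induction t with
  | zero => rfl
  | succ t ih =>
    rw [pow_succ, Module.End.mul_apply, h, ← Module.End.mul_apply, (hPQ.pow_left t).eq,
      Module.End.mul_apply, ih, pow_succ', Module.End.mul_apply]

/-- By coprimality two exponent vectors of equal degree differ by a multiple of `(b, -a)`, so the
single binomial `P^b - Q^a` implies all the others. -/
theorem toric_apply_eq {V : Type*} [AddCommGroup V] [Module ℂ V] {P Q : Module.End ℂ V}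
    (hPQ : Commute P Q) {a b : ℕ} (hb : 0 < b) (hab : Nat.Coprime a b) {F : V}
    (h : (P ^ b) F = (Q ^ a) F) {u₀ u₁ v₀ v₁ : ℕ} (huv : a * u₀ + b * u₁ = a * v₀ + b * v₁) :
    (P ^ u₀ * Q ^ u₁) F = (P ^ v₀ * Q ^ v₁) F := by
  wlog hle : v₀ ≤ u₀ generalizing u₀ u₁ v₀ v₁
  · exact (this huv.symm (by omega)).symm
  obtain ⟨w, rfl⟩ := Nat.exists_eq_add_of_le hle
  have h1 : a * w + b * u₁ = b * v₁ := by nlinarith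
  have h2 : b ∣ w := by
    refine hab.symm.dvd_of_dvd_mul_left ((Nat.dvd_add_left (dvd_mul_right b u₁)).1 ?_)
    rw [h1]; exact dvd_mul_right _ _
  obtain ⟨t, rfl⟩ := h2
  have h3 : v₁ = u₁ + a * t := by
    refine Nat.eq_of_mul_eq_mul_left hb ?_
    rw [← h1]; ring
  have h4 := pow_apply_eq_pow_apply (hPQ.pow_pow b a) h t
  rw [← pow_mul, ← pow_mul] at h4
  rw [h3, pow_add, mul_assoc, (hPQ.pow_pow (b * t) u₁).eq, ← mul_assoc, pow_add, ← mul_assoc,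
    Module.End.mul_apply, h4, ← Module.End.mul_apply]

theorem pderiv_castSucc {d : ℕ} (p : Fin d → ℂ) (i : Fin d) :
    pderiv p i.castSucc = derivBase p i := by
  simp [pderiv]

theorem pderiv_last {d : ℕ} (p : Fin d → ℂ) : pderiv p (Fin.last d) = derivNormal p := by
  simp [pderiv]

theorem mulX_castSucc {d : ℕ} (p : Fin d → ℂ) (i : Fin d) :
    mulX p i.castSucc = mulBase p i := by
  simp [mulX]

theorem mulX_last {d : ℕ} (p : Fin d → ℂ) : mulX p (Fin.last d) = mulNormal p := by
  simp [mulX]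

theorem mem_Sol_two_iff {a b : ℕ} (hab : Nat.Coprime a b) (hb : 0 < b) {p : Fin 1 → ℂ} {β : ℂ}
    {s : ℝ} {F : FormalGerm p} : F ∈ Sol p ![a, b] β s ↔ F ∈ Gevrey p s ∧
      (derivBase p 0 ^ b) F = (derivNormal p ^ a) F ∧
      (a : ℂ) • mulBase p 0 (derivBase p 0 F) + (b : ℂ) • mulNormal p (derivNormal p F) =
        β • F := by
  have h0 : pderiv p 0 = derivBase p 0 := pderiv_castSucc p 0
  have h1 : pderiv p 1 = derivNormal p := pderiv_last p
  have h2 : mulX p 0 = mulBase p 0 := mulX_castSucc p 0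
  have h3 : mulX p 1 = mulNormal p := mulX_last p
  have hE : ∑ i, ((![a, b] i : ℕ) : ℂ) • mulX p i (pderiv p i F) =
      (a : ℂ) • mulBase p 0 (derivBase p 0 F) + (b : ℂ) • mulNormal p (derivNormal p F) := by
    rw [Fin.sum_univ_two, h0, h1, h2, h3]; rfl
  have hT : ∀ u : Fin 2 → ℕ, (List.ofFn fun i => pderiv p i ^ u i).prod =
      derivBase p 0 ^ u 0 * derivNormal p ^ u 1 := by
    intro u
    simp [List.ofFn_succ, h0, h1]
  rw [mem_Sol_iff, hE]
  refine and_congr_right fun _ => and_congr_left fun _ => ⟨fun h => ?_, fun h u v huv => ?_⟩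
  · have := h ![b, 0] ![0, a] (by simp [Fin.sum_univ_two, mul_comm])
    rw [hT, hT] at this
    simpa using this
  · rw [hT, hT]
    exact toric_apply_eq (commute_derivBase_derivNormal p 0) hb hab h
      (by simpa [Fin.sum_univ_two] using huv)

theorem mem_Sol_three_iff {m n : ℕ} {p : Fin 2 → ℂ} {β : ℂ}
    {s : ℝ} {F : FormalGerm p} : F ∈ Sol p ![1, m, n] β s ↔ F ∈ Gevrey p s ∧
      (derivBase p 1 F = (derivBase p 0 ^ m) F ∧ derivNormal p F = (derivBase p 0 ^ n) F) ∧
      mulBase p 0 (derivBase p 0 F) + (m : ℂ) • mulBase p 1 (derivBase p 1 F) +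
        (n : ℂ) • mulNormal p (derivNormal p F) = β • F := by
  have h0 : pderiv p 0 = derivBase p 0 := pderiv_castSucc p 0
  have h1 : pderiv p 1 = derivBase p 1 := pderiv_castSucc p 1
  have h2 : pderiv p 2 = derivNormal p := pderiv_last p
  have h3 : mulX p 0 = mulBase p 0 := mulX_castSucc p 0
  have h4 : mulX p 1 = mulBase p 1 := mulX_castSucc p 1
  have h5 : mulX p 2 = mulNormal p := mulX_last p
  have hE : ∑ i, ((![1, m, n] i : ℕ) : ℂ) • mulX p i (pderiv p i F) =
      mulBase p 0 (derivBase p 0 F) + (m : ℂ) • mulBase p 1 (derivBase p 1 F) +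
        (n : ℂ) • mulNormal p (derivNormal p F) := by
    rw [Fin.sum_univ_three, h0, h1, h2, h3, h4, h5]
    simp
  have hT : ∀ u : Fin 3 → ℕ, (List.ofFn fun i => pderiv p i ^ u i).prod =
      derivBase p 0 ^ u 0 * (derivBase p 1 ^ u 1 * derivNormal p ^ u 2) := by
    intro u
    simp [List.ofFn_succ, h0, h1, h2]
  rw [mem_Sol_iff, hE]
  refine and_congr_right fun _ => and_congr_left fun _ => ⟨fun h => ?_, fun h u v huv => ?_⟩
  · have h6 := h ![0, 1, 0] ![m, 0, 0] (by simp [Fin.sum_univ_three])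
    have h7 := h ![0, 0, 1] ![n, 0, 0] (by simp [Fin.sum_univ_three])
    rw [hT, hT] at h6 h7
    exact ⟨by simpa using h6, by simpa using h7⟩
  -- Because the first entry of the row is `1`, every monomial of degree `N` acts on `F` as `∂_0^N`.
  · have key : ∀ u : Fin 3 → ℕ,
        (derivBase p 0 ^ u 0 * (derivBase p 1 ^ u 1 * derivNormal p ^ u 2)) F =
          (derivBase p 0 ^ (∑ i, ![1, m, n] i * u i)) F := by
      intro u
      have h8 := pow_apply_eq_pow_apply ((commute_derivBase p 1 0).pow_right m) h.1 (u 1)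
      have h9 := pow_apply_eq_pow_apply ((commute_derivBase_derivNormal p 0).symm.pow_right n)
        h.2 (u 2)
      rw [← pow_mul] at h8 h9
      rw [Module.End.mul_apply, Module.End.mul_apply, h9,
        ← Module.End.mul_apply (derivBase p 1 ^ u 1),
        ((commute_derivBase p 1 0).pow_pow (u 1) (n * u 2)).eq, Module.End.mul_apply, h8,
        ← Module.End.mul_apply, ← Module.End.mul_apply, ← pow_add, ← pow_add]
      congr 2
      simp [Fin.sum_univ_three]
      ring
    rw [hT, hT, key, key, huv]

/-! ### Series with monomial coefficients -/

theorem poch_zero (z : ℂ) : poch z 0 = 1 := by simp [poch]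

theorem poch_succ (z : ℂ) (n : ℕ) : poch z (n + 1) = poch z n * (z - n) := by
  simp [poch, descPochhammer_succ_right]

theorem poch_add (z : ℂ) (m n : ℕ) : poch z (m + n) = poch z m * poch (z - m) n := by
  induction n with
  | zero => simp [poch_zero]
  | succ n ih => rw [← add_assoc, poch_succ, ih, poch_succ]; push_cast; ring

theorem poch_eq_zero_iff (z : ℂ) (n : ℕ) : poch z n = 0 ↔ ∃ i < n, z = i := by
  induction n with
  | zero => simp [poch_zero]
  | succ n ih =>
    rw [poch_succ, mul_eq_zero, ih, sub_eq_zero]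
    constructor
    · rintro (⟨i, hi, rfl⟩ | rfl)
      · exact ⟨i, by omega, rfl⟩
      · exact ⟨n, by omega, rfl⟩
    · rintro ⟨i, hi, rfl⟩
      rcases Nat.lt_succ_iff_lt_or_eq.1 hi with h | rfl
      · exact Or.inl ⟨i, h, rfl⟩
      · exact Or.inr rfl

theorem norm_poch_le {z : ℂ} {B : ℝ} {n : ℕ} (h : ∀ i < n, ‖z - i‖ ≤ B) : ‖poch z n‖ ≤ B ^ n := by
  induction n with
  | zero => simp [poch_zero]
  | succ n ih =>
    rw [poch_succ, norm_mul, pow_succ]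
    have h1 := h n (by omega)
    exact mul_le_mul (ih fun i hi => h i (by omega)) h1 (norm_nonneg _)
      (pow_nonneg ((norm_nonneg _).trans h1) _)

theorem poch_natCast (m n : ℕ) : poch ((m + n : ℕ) : ℂ) n = (m + n).factorial / m.factorial := by
  rw [poch, descPochhammer_eval_eq_descFactorial,
    Nat.descFactorial_eq_div (Nat.le_add_left n m), Nat.add_sub_cancel,
    Nat.cast_div (Nat.factorial_dvd_factorial (Nat.le_add_right m n))
      (by exact_mod_cast m.factorial_ne_zero)]

/-- Differentiate `exp (L x) = x`. Writing `1/x` as `exp (-L x)` lets all powers of `x_1` be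
multiplied by adding exponents. -/
theorem IsLogBranch.eventually_hasDerivAt {L : ℂ → ℂ} {ε : ℂ} (hL : IsLogBranch L ε) :
    ∀ᶠ x in 𝓝 ε, AnalyticAt ℂ L x ∧ HasDerivAt L (Complex.exp (-L x)) x ∧
      Complex.exp (L x) = x := by
  filter_upwards [hL.1.eventually_analyticAt, hL.2.eventually_nhds] with x h1 h2
  refine ⟨h1, ?_, h2.self_of_nhds⟩
  have h3 := h1.differentiableAt.hasDerivAt
  have h4 : HasDerivAt (fun x => Complex.exp (L x)) 1 x :=
    (hasDerivAt_id x).congr_of_eventuallyEq h2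
  have h5 := h3.cexp.unique h4
  refine h3.congr_deriv ?_
  rw [Complex.exp_neg]
  exact eq_inv_of_mul_eq_one_right h5

theorem exists_isLogBranch {ε : ℂ} (hε : ε ≠ 0) : ∃ L, IsLogBranch L ε := by
  refine ⟨fun x => Complex.log (x / ε) + Complex.log ε, ?_, ?_⟩
  · have h1 : AnalyticAt ℂ (fun x : ℂ => x / ε) ε := analyticAt_id.div_const
    refine (h1.clog ?_).add analyticAt_const
    rw [div_self hε]; exact Complex.one_mem_slitPlane
  · filter_upwards [isOpen_ne.mem_nhds hε] with x hx
    rw [Complex.exp_add, Complex.exp_log (div_ne_zero hx hε), Complex.exp_log hε,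
      div_mul_cancel₀ _ hε]

/-! ### Series `∑ₙ e_n x_1^(z_n) x_2ⁿ` and the action of the operators on them. -/

section Monomials

variable {L : ℂ → ℂ} {p : Fin 1 → ℂ}

theorem tendsto_coord_zero (p : Fin 1 → ℂ) : Tendsto (fun y : Fin 1 → ℂ => y 0) (𝓝 p) (𝓝 (p 0)) :=
  (continuous_apply 0).continuousAt

theorem holAlong_mono (hL : IsLogBranch L (p 0)) (z e : ℕ → ℂ) :
    HolAlong p fun y n => e n * Complex.exp (z n * L (y 0)) := by
  filter_upwards [(tendsto_coord_zero p).eventually hL.1.eventually_analyticAt] with y hy n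
  exact analyticAt_const.mul (AnalyticAt.cexp' (analyticAt_const.mul
    (AnalyticAt.fun_comp hy (analyticAt_coord 0 y))))

/-- The germ of `∑ₙ e_n x_1^(z_n) x_2ⁿ`. -/
def mono (hL : IsLogBranch L (p 0)) (z : ℕ → ℂ) : (ℕ → ℂ) →ₗ[ℂ] FormalGerm p where
  toFun e := FormalGerm.mk (fun y n => e n * Complex.exp (z n * L (y 0))) (holAlong_mono hL z e)
  map_add' e e' := Subtype.ext (Germ.coe_eq.2 (Eventually.of_forall fun y => by
    funext n; simp [add_mul]))
  map_smul' c e := Subtype.ext (Germ.coe_eq.2 (Eventually.of_forall fun y => by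
    funext n; simp [mul_assoc]))

theorem mono_injective (hL : IsLogBranch L (p 0)) (z : ℕ → ℂ) :
    Function.Injective (mono hL z) := by
  intro e e' h
  have h1 := (Germ.coe_eq.1 (congrArg Subtype.val h)).self_of_nhds
  funext n
  exact mul_right_cancel₀ (Complex.exp_ne_zero _) (congrFun h1 n)

theorem hasFDerivAt_mono {y : Fin 1 → ℂ} (hy : HasDerivAt L (Complex.exp (-L (y 0))) (y 0))
    (e z : ℂ) : HasFDerivAt (fun y : Fin 1 → ℂ => e * Complex.exp (z * L (y 0)))
      ((z * e * Complex.exp ((z - 1) * L (y 0))) •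
        (ContinuousLinearMap.proj 0 : (Fin 1 → ℂ) →L[ℂ] ℂ)) y := by
  have h1 : HasDerivAt (fun x => e * Complex.exp (z * L x))
      (z * e * Complex.exp ((z - 1) * L (y 0))) (y 0) := by
    refine (((hy.const_mul z).cexp).const_mul e).congr_deriv ?_
    rw [show (z - 1) * L (y 0) = z * L (y 0) + -L (y 0) by ring, Complex.exp_add]
    ring
  exact h1.comp_hasFDerivAt (f := fun y : Fin 1 → ℂ => y 0) y
    (ContinuousLinearMap.proj 0 : (Fin 1 → ℂ) →L[ℂ] ℂ).hasFDerivAt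

theorem derivBase_mono (hL : IsLogBranch L (p 0)) (z e : ℕ → ℂ) :
    derivBase p 0 (mono hL z e) = mono hL (fun n => z n - 1) fun n => z n * e n := by
  refine Subtype.ext (Germ.coe_eq.2 ?_)
  filter_upwards [(tendsto_coord_zero p).eventually hL.eventually_hasDerivAt] with y hy
  funext n
  change fderiv ℂ (fun y : Fin 1 → ℂ => e n * Complex.exp (z n * L (y 0))) y (Pi.single 0 1) = _
  rw [(hasFDerivAt_mono hy.2.1 (e n) (z n)).fderiv]
  simp

theorem mulBase_mono (hL : IsLogBranch L (p 0)) (z e : ℕ → ℂ) :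
    mulBase p 0 (mono hL z e) = mono hL (fun n => z n + 1) e := by
  refine Subtype.ext (Germ.coe_eq.2 ?_)
  filter_upwards [(tendsto_coord_zero p).eventually hL.eventually_hasDerivAt] with y hy
  funext n
  change y 0 * (e n * Complex.exp (z n * L (y 0))) = e n * Complex.exp ((z n + 1) * L (y 0))
  rw [add_mul, one_mul, Complex.exp_add, hy.2.2]
  ring

theorem derivNormal_mono (hL : IsLogBranch L (p 0)) (z e : ℕ → ℂ) :
    derivNormal p (mono hL z e) =
      mono hL (fun n => z (n + 1)) fun n => ((n : ℂ) + 1) * e (n + 1) := by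
  refine Subtype.ext (Germ.coe_eq.2 (Eventually.of_forall fun y => ?_))
  funext n
  exact (mul_assoc _ _ _).symm

theorem mulNormal_derivNormal_mono (hL : IsLogBranch L (p 0)) (z e : ℕ → ℂ) :
    mulNormal p (derivNormal p (mono hL z e)) = mono hL z fun n => (n : ℂ) * e n := by
  refine Subtype.ext (Germ.coe_eq.2 (Eventually.of_forall fun y => ?_))
  funext n
  cases n with
  | zero => simp
  | succ n => simp [mul_assoc]

theorem derivBase_pow_mono (hL : IsLogBranch L (p 0)) (z e : ℕ → ℂ) (b : ℕ) :
    (derivBase p 0 ^ b) (mono hL z e) =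
      mono hL (fun n => z n - b) fun n => poch (z n) b * e n := by
  induction b with
  | zero => simp [poch_zero]
  | succ b ih =>
    rw [pow_succ', Module.End.mul_apply, ih, derivBase_mono]
    congr 2
    · funext n; push_cast; ring
    · funext n; rw [poch_succ]; ring

theorem derivNormal_pow_mono (hL : IsLogBranch L (p 0)) (z e : ℕ → ℂ) (a : ℕ) :
    (derivNormal p ^ a) (mono hL z e) =
      mono hL (fun n => z (n + a)) fun n => ((n + a).factorial / n.factorial : ℂ) * e (n + a) := by
  induction a with
  | zero =>
    change mono hL z e = _
    congr 1
    funext n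
    simp [div_self (Nat.cast_ne_zero.2 n.factorial_ne_zero : (n.factorial : ℂ) ≠ 0)]
  | succ a ih =>
    rw [pow_succ', Module.End.mul_apply, ih, derivNormal_mono]
    congr 2
    · funext n; congr 1; ring
    · funext n
      have h1 : (n.factorial : ℂ) ≠ 0 := Nat.cast_ne_zero.2 n.factorial_ne_zero
      have h2 : (n : ℂ) + 1 ≠ 0 := by exact_mod_cast n.succ_ne_zero
      rw [show n + 1 + a = n + (a + 1) by ring, Nat.factorial_succ n]
      push_cast
      field_simp

/-- The exponents of `x_1` in the solutions of the Euler equation `a θ₁ + b θ₂ = β`. -/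
def eulerExp (a b : ℕ) (β : ℂ) (n : ℕ) : ℂ := (β - n * b) / a

theorem euler_mono (hL : IsLogBranch L (p 0)) {a : ℕ} (ha : 1 ≤ a) (b : ℕ) (β : ℂ) (e : ℕ → ℂ) :
    (a : ℂ) • mulBase p 0 (derivBase p 0 (mono hL (eulerExp a b β) e)) +
      (b : ℂ) • mulNormal p (derivNormal p (mono hL (eulerExp a b β) e)) =
        β • mono hL (eulerExp a b β) e := by
  have ha0 : (a : ℂ) ≠ 0 := by exact_mod_cast (by omega : a ≠ 0)
  rw [derivBase_mono, mulBase_mono, mulNormal_derivNormal_mono]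
  simp only [sub_add_cancel]
  rw [← map_smul, ← map_smul, ← map_smul, ← map_add]
  congr 1
  funext n
  simp only [Pi.add_apply, Pi.smul_apply, smul_eq_mul, eulerExp]
  field_simp
  ring

/-- On coefficients the Euler equation is the first order equation `x_1 f_n' = z_n f_n` with `z_n =
(β-nb)/a`, whose solutions are the multiples of `x_1^(z_n)`. -/
theorem exists_eq_mono_of_euler (hL : IsLogBranch L (p 0)) {a : ℕ} (ha : 1 ≤ a) {b : ℕ} {β : ℂ}
    {F : FormalGerm p} (hF : (a : ℂ) • mulBase p 0 (derivBase p 0 F) +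
      (b : ℂ) • mulNormal p (derivNormal p F) = β • F) :
    ∃ e, F = mono hL (eulerExp a b β) e := by
  have ha0 : (a : ℂ) ≠ 0 := by exact_mod_cast (by omega : a ≠ 0)
  obtain ⟨f, hf, rfl⟩ := F.exists_mk
  have h1 : ∀ᶠ y in 𝓝 p, ∀ n, (a : ℂ) * (y 0 * fderiv ℂ (fun z => f z n) y (Pi.single 0 1)) +
      b * (n * f y n) = β * f y n := by
    filter_upwards [Germ.coe_eq.1 (congrArg Subtype.val hF)] with y hy n
    refine Eq.trans ?_ (congrFun hy n)
    cases n with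
    | zero => simp
    | succ n => simp
  obtain ⟨r, hr, hball⟩ := Metric.eventually_nhds_iff_ball.1 ((hf.and h1).and
    ((tendsto_coord_zero p).eventually hL.eventually_hasDerivAt))
  refine ⟨fun n => f p n * Complex.exp (-eulerExp a b β n * L (p 0)),
    Subtype.ext (Germ.coe_eq.2 ?_)⟩
  filter_upwards [Metric.ball_mem_nhds _ hr] with y hy
  funext n
  set z := eulerExp a b β n with hz
  -- `f_n x_1^(-z_n)` has zero derivative, on a ball that does not depend on `n`.
  have hder : ∀ w ∈ Metric.ball p r,
      HasFDerivAt (fun y : Fin 1 → ℂ => f y n * (1 * Complex.exp (-z * L (y 0))))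
      (0 : (Fin 1 → ℂ) →L[ℂ] ℂ) w := by
    intro w hw
    obtain ⟨⟨h2, h3⟩, h4, h5, h6⟩ := hball w hw
    refine ((h2 n).differentiableAt.hasFDerivAt.mul (hasFDerivAt_mono h5 1 (-z))).congr_fderiv ?_
    refine ContinuousLinearMap.ext fun v => ?_
    have hv : v = v 0 • (Pi.single 0 1 : Fin 1 → ℂ) := by
      funext i; fin_cases i; simp
    rw [hv, map_smul, zero_apply]
    refine smul_eq_zero_of_right _ ?_
    have h7 := h3 n
    have hw0 : w 0 ≠ 0 := by rw [← h6]; exact Complex.exp_ne_zero _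
    have h8 : fderiv ℂ (fun z => f z n) w (Pi.single 0 1) = z * f w n / w 0 := by
      rw [hz, eulerExp]
      field_simp
      linear_combination h7
    have h9 : Complex.exp ((-z - 1) * L (w 0)) = Complex.exp (-z * L (w 0)) / w 0 := by
      rw [sub_mul, one_mul, Complex.exp_sub, h6]
    simp only [add_apply, smul_apply, smul_eq_mul, h8, h9,
      ContinuousLinearMap.proj_apply, Pi.single_eq_same]
    field_simp
    ring
  have hconst := Metric.isOpen_ball.is_const_of_fderiv_eq_zero (𝕜 := ℂ)
    (convex_ball p r).isPreconnected
    (fun w hw => (hder w hw).differentiableAt.differentiableWithinAt)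
    (fun w hw => (hder w hw).fderiv) hy (Metric.mem_ball_self hr)
  simp only [one_mul] at hconst
  change f y n = f p n * Complex.exp (-z * L (p 0)) * Complex.exp (z * L (y 0))
  rw [← hconst, mul_assoc, ← Complex.exp_add]
  simp

theorem toric_mono_iff (hL : IsLogBranch L (p 0)) {a : ℕ} (ha : 1 ≤ a) (b : ℕ) (β : ℂ)
    (e : ℕ → ℂ) :
    (derivBase p 0 ^ b) (mono hL (eulerExp a b β) e) =
      (derivNormal p ^ a) (mono hL (eulerExp a b β) e) ↔
    ∀ n, poch (eulerExp a b β n) b * (n.factorial * e n) = (n + a).factorial * e (n + a) := by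
  have ha0 : (a : ℂ) ≠ 0 := by exact_mod_cast (by omega : a ≠ 0)
  rw [derivBase_pow_mono, derivNormal_pow_mono]
  -- Applying `∂_1^b` and `∂_2^a` leads to the same powers of `x_1`, so only the constants remain to
  -- be compared.
  have h1 : (fun n => eulerExp a b β n - b) = fun n => eulerExp a b β (n + a) := by
    funext n
    rw [eulerExp, eulerExp]
    push_cast
    field_simp
    ring
  rw [h1, (mono_injective hL _).eq_iff, funext_iff]
  refine forall_congr' fun n => ?_
  have h2 : (n.factorial : ℂ) ≠ 0 := Nat.cast_ne_zero.2 n.factorial_ne_zero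
  rw [div_mul_eq_mul_div, eq_div_iff h2]
  constructor <;> intro h <;> linear_combination h

end Monomials

/-! ### Gevrey estimates -/

/-- If `G(u,v) = ∑ c_{i,n} uⁱ vⁿ`, the rescaled series is `A(y) G(U(y), V(y) t)`, analytic near `(p,
0)` because `U p = 0`. This one criterion serves both systems. -/
theorem mk_mem_Gevrey {d : ℕ} {p : Fin d → ℂ} {s : ℝ} {f : (Fin d → ℂ) → ℕ → ℂ}
    (hf : HolAlong p f) {c : ℕ → ℕ → ℂ} {M K : ℝ} (hc : ∀ i j, ‖c i j‖ ≤ M * K ^ (i + j))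
    (hM : 0 ≤ M) (hK : 0 < K) {A U V : (Fin d → ℂ) → ℂ} (hA : AnalyticAt ℂ A p)
    (hU : AnalyticAt ℂ U p) (hV : AnalyticAt ℂ V p) (hU0 : U p = 0)
    (h : ∀ᶠ y in 𝓝 p, ∀ n, f y n / (((n.factorial : ℝ) ^ (s - 1) : ℝ) : ℂ) =
      A y * (∑' i, c i n * U y ^ i) * V y ^ n) :
    FormalGerm.mk f hf ∈ Gevrey p s := by
  obtain ⟨G, hG, hsum⟩ := exists_analyticAt_hasSum hc hM hK
  have hfst : AnalyticAt ℂ (fun z : (Fin d → ℂ) × ℂ => z.1) (p, 0) := analyticAt_fst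
  have hUz : AnalyticAt ℂ (fun z : (Fin d → ℂ) × ℂ => U z.1) (p, 0) :=
    AnalyticAt.fun_comp (g := U) hU hfst
  have hVz : AnalyticAt ℂ (fun z : (Fin d → ℂ) × ℂ => V z.1 * z.2) (p, 0) :=
    (AnalyticAt.fun_comp (g := V) hV hfst).mul analyticAt_snd
  refine ⟨f, rfl, fun z => A z.1 * G (U z.1, V z.1 * z.2),
    (AnalyticAt.fun_comp (g := A) hA hfst).mul
      (AnalyticAt.fun_comp (g := G) (by simpa [hU0] using hG) (hUz.prod hVz)), ?_⟩
  have hpos : 0 < 1 / (2 * K) := by positivity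
  have h1 : ∀ᶠ z : (Fin d → ℂ) × ℂ in 𝓝 (p, 0), ‖U z.1‖ < 1 / (2 * K) :=
    hUz.continuousAt.norm.eventually_lt continuousAt_const (by simpa [hU0] using hpos)
  have h2 : ∀ᶠ z : (Fin d → ℂ) × ℂ in 𝓝 (p, 0), ‖V z.1 * z.2‖ < 1 / (2 * K) :=
    hVz.continuousAt.norm.eventually_lt continuousAt_const (by simpa using hpos)
  filter_upwards [h1, h2, hfst.continuousAt.eventually h] with z hz1 hz2 hz3
  refine ((hsum _ _ hz1 hz2).mul_left (A z.1)).congr_fun fun n => ?_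
  rw [hz3 n, mul_pow]
  ring

theorem ofReal_rpow_sub_one_mul_factorial (n : ℕ) (s : ℝ) :
    (((n.factorial : ℝ) ^ (s - 1) : ℝ) : ℂ) * n.factorial =
      (((n.factorial : ℝ) ^ s : ℝ) : ℂ) := by
  have h : (n.factorial : ℝ) ≠ 0 := by positivity
  rw [Real.rpow_sub_one h, Complex.ofReal_div, Complex.ofReal_natCast,
    div_mul_cancel₀ _ (by exact_mod_cast h)]

/-! ### The system of `(a, b)`: Gevrey order of its formal solutions, and the series `ψ`. -/

section PlaneSystem

variable {L : ℂ → ℂ} {p : Fin 1 → ℂ}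

theorem mono_mem_Gevrey (hL : IsLogBranch L (p 0)) {a b : ℕ} (ha : 1 ≤ a) {β : ℂ} {s : ℝ}
    (hs : (b : ℝ) / a ≤ s) {e : ℕ → ℂ}
    (he : ∀ n, poch (eulerExp a b β n) b * (n.factorial * e n) =
      (n + a).factorial * e (n + a)) : mono hL (eulerExp a b β) e ∈ Gevrey p s := by
  have ha0 : (a : ℂ) ≠ 0 := by exact_mod_cast (by omega : a ≠ 0)
  have ha1 : (1 : ℝ) ≤ a := by exact_mod_cast ha
  -- `[z_n]_b` has `b` factors, each at most `(‖β‖ + 2b)(n + 1)`; hence `n! e_n` grows at most like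
  -- `Kⁿ (n!)^(b/a)`.
  obtain ⟨M, K, hM, hK, hE⟩ := exists_bound_of_recurrence (b := b) ha
    (C := (‖β‖ + 2 * b) ^ b) (E := fun n => n.factorial * e n) (by
      intro n
      rw [← he n, norm_mul, ← mul_pow]
      gcongr
      refine norm_poch_le fun i hi => ?_
      have h1 : ‖eulerExp a b β n‖ ≤ ‖β‖ + n * b := by
        rw [eulerExp, norm_div, Complex.norm_natCast]
        refine (div_le_self (norm_nonneg _) ha1).trans ((norm_sub_le _ _).trans ?_)
        simp
      have h2 : (i : ℝ) ≤ b := by exact_mod_cast hi.le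
      calc ‖eulerExp a b β n - i‖ ≤ ‖eulerExp a b β n‖ + ‖(i : ℂ)‖ := norm_sub_le _ _
        _ ≤ (‖β‖ + n * b) + b := by rw [Complex.norm_natCast]; gcongr
        _ ≤ (‖β‖ + 2 * b) * (n + 1) := by
          nlinarith [mul_nonneg (norm_nonneg β) (Nat.cast_nonneg n : (0 : ℝ) ≤ n),
            mul_nonneg (Nat.cast_nonneg b : (0 : ℝ) ≤ b) (Nat.cast_nonneg n : (0 : ℝ) ≤ n)])
  have hLy : AnalyticAt ℂ (fun y : Fin 1 → ℂ => L (y 0)) p :=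
    AnalyticAt.fun_comp hL.1 (analyticAt_coord 0 p)
  -- Only `i = 0` is used: `A = x_1^(β/a)`, `U = 0`, and `V = x_1^(-b/a)` carries the dependence of
  -- the exponents on `n`.
  refine mk_mem_Gevrey (holAlong_mono hL _ e)
    (c := fun i n => if i = 0 then n.factorial * e n / (((n.factorial : ℝ) ^ s : ℝ) : ℂ) else 0)
    (M := M) (K := K) (A := fun y => Complex.exp (β / a * L (y 0))) (U := fun _ => 0)
    (V := fun y => Complex.exp (-(b / a) * L (y 0))) ?_ hM (by linarith)
    (analyticAt_const.mul hLy).cexp' analyticAt_const (analyticAt_const.mul hLy).cexp' rfl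
    (Eventually.of_forall fun y n => ?_)
  · intro i n
    split_ifs with hi
    · have h3 : (1 : ℝ) ≤ n.factorial := by exact_mod_cast n.factorial_pos
      rw [norm_div, Complex.norm_of_nonneg (by positivity), div_le_iff₀ (by positivity), hi,
        zero_add]
      refine (hE n).trans ?_
      gcongr
    · rw [norm_zero]; positivity
  · have h4 : (((n.factorial : ℝ) ^ (s - 1) : ℝ) : ℂ) ≠ 0 := by
      rw [Complex.ofReal_ne_zero]; positivity
    have h5 : (n.factorial : ℂ) ≠ 0 := Nat.cast_ne_zero.2 n.factorial_ne_zero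
    rw [tsum_eq_single 0 (fun i hi => by simp [hi])]
    simp only [if_true, pow_zero, mul_one]
    rw [← ofReal_rpow_sub_one_mul_factorial n s, ← Complex.exp_nat_mul]
    have h6 : Complex.exp (eulerExp a b β n * L (y 0)) = Complex.exp (β / a * L (y 0)) *
        Complex.exp (n * (-(b / a) * L (y 0))) := by
      rw [← Complex.exp_add, eulerExp]
      congr 1
      field_simp
      ring
    rw [h6]
    field_simp

theorem mono_mem_Sol_iff (hL : IsLogBranch L (p 0)) {a b : ℕ} (ha : 1 ≤ a) (hb : 0 < b)
    (hab : Nat.Coprime a b) {β : ℂ} {s : ℝ} (hs : (b : ℝ) / a ≤ s) {e : ℕ → ℂ} :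
    mono hL (eulerExp a b β) e ∈ Sol p ![a, b] β s ↔
      ∀ n, poch (eulerExp a b β n) b * (n.factorial * e n) = (n + a).factorial * e (n + a) := by
  rw [mem_Sol_two_iff hab hb, toric_mono_iff hL ha]
  exact ⟨fun h => h.2.1, fun h => ⟨mono_mem_Gevrey hL ha hs h, h, euler_mono hL ha b β e⟩⟩

theorem eq_of_recurrence {a b : ℕ} (ha : 1 ≤ a) {β : ℂ} {e e' : ℕ → ℂ}
    (he : ∀ n, poch (eulerExp a b β n) b * (n.factorial * e n) = (n + a).factorial * e (n + a))
    (he' : ∀ n, poch (eulerExp a b β n) b * (n.factorial * e' n) = (n + a).factorial * e' (n + a))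
    (h : ∀ n < a, e n = e' n) : e = e' := by
  funext n
  induction n using Nat.strong_induction_on with
  | _ n ih =>
    rcases lt_or_ge n a with hn | hn
    · exact h n hn
    · obtain ⟨m, rfl⟩ : ∃ m, n = m + a := ⟨n - a, by omega⟩
      have h1 := he m
      rw [ih m (by omega), he' m] at h1
      exact (mul_left_cancel₀ (Nat.cast_ne_zero.2 (m + a).factorial_ne_zero) h1).symm

/-- The coefficients of `psi`. -/
def psiSeq (a b : ℕ) (β : ℂ) (j : Fin a) (n : ℕ) : ℂ :=
  if n % a = j then
    poch ((β - (j : ℕ) * b) / a) (b * (n / a)) / poch ((a * (n / a) + j : ℕ) : ℂ) (a * (n / a))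
  else 0

theorem psi_eq_mono (hL : IsLogBranch L (p 0)) {a : ℕ} (b : ℕ) (β : ℂ) (j : Fin a) :
    psi a b β hL j = mono hL (eulerExp a b β) (psiSeq a b β j) := by
  have ha0 : (a : ℂ) ≠ 0 := by exact_mod_cast (by have := j.2; omega : a ≠ 0)
  refine Subtype.ext (Germ.coe_eq.2 (Eventually.of_forall fun y => ?_))
  funext n
  change psiCoeff a b β L j y n = psiSeq a b β j n * Complex.exp (eulerExp a b β n * L (y 0))
  rw [psiCoeff, psiSeq]
  split_ifs with hn
  · congr 3
    have h1 : (n : ℂ) = a * (n / a : ℕ) + (j : ℕ) := by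
      have := Nat.div_add_mod n a
      rw [hn] at this
      exact_mod_cast this.symm
    rw [eulerExp, h1]
    field_simp
    ring
  · simp

theorem psiSeq_of_lt {a b : ℕ} {β : ℂ} {j : Fin a} {n : ℕ} (hn : n < a) :
    psiSeq a b β j n = if n = j then 1 else 0 := by
  simp [psiSeq, Nat.mod_eq_of_lt hn, Nat.div_eq_of_lt hn, poch_zero]

/-- As `[am+j]_{am} = (am+j)!/j!`, multiplying the coefficient by `n!` leaves `j! [(β-jb)/a]_{bm}`,
and the recurrence is `[z]_{bm+b} = [z]_{bm} [z-bm]_b`. -/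
theorem psiSeq_recurrence (a b : ℕ) (β : ℂ) (j : Fin a) (n : ℕ) :
    poch (eulerExp a b β n) b * (n.factorial * psiSeq a b β j n) =
      (n + a).factorial * psiSeq a b β j (n + a) := by
  have hapos : 0 < a := by have := j.2; omega
  have ha0 : (a : ℂ) ≠ 0 := by exact_mod_cast hapos.ne'
  rw [psiSeq, psiSeq, Nat.add_mod_right, Nat.add_div_right n hapos]
  split_ifs with hn
  · obtain ⟨m, rfl⟩ : ∃ m, n = a * m + j :=
      ⟨n / a, by have := Nat.div_add_mod n a; rw [hn] at this; exact this.symm⟩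
    have h1 : (a * m + j) / a = m := by
      rw [Nat.mul_add_div hapos, Nat.div_eq_of_lt j.2, add_zero]
    have h2 : ∀ m : ℕ, poch ((a * m + j : ℕ) : ℂ) (a * m) =
        (a * m + j).factorial / (j : ℕ).factorial := by
      intro m
      rw [add_comm, poch_natCast]
    rw [h1, h2, h2, mul_add_one, poch_add,
      show a * m + j + a = a * (m + 1) + j by ring]
    have h3 : eulerExp a b β (a * m + j) = (β - (j : ℕ) * b) / a - (b * m : ℕ) := by
      rw [eulerExp]
      push_cast
      field_simp
      ring
    have h4 : ((a * m + j).factorial : ℂ) ≠ 0 := Nat.cast_ne_zero.2 (Nat.factorial_ne_zero _)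
    have h5 : ((a * (m + 1) + j).factorial : ℂ) ≠ 0 := Nat.cast_ne_zero.2 (Nat.factorial_ne_zero _)
    rw [h3]
    field_simp
  · simp

end PlaneSystem

/-! ### Solutions of the system of `(1, ka, kb)` -/

/-- Up to geometric factors `(i+kbn)!` is at most `i! (n!)^(kb)`. Its power `1/(ka)` is at most `i!
(n!)^(b/a)`, which the denominators absorb since `b/a ≤ s`. -/
theorem norm_div_factorial_rpow_le {D : ℕ → ℂ} {M K s : ℝ} {a b k : ℕ} (ha : 1 ≤ a) (hb : 1 ≤ b)
    (hk : 1 ≤ k) (hM : 0 ≤ M) (hK : 1 ≤ K) (hs : (b : ℝ) / a ≤ s)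
    (hD : ∀ n, ‖D n‖ ≤ M * K ^ n * (n.factorial : ℝ) ^ (1 / (k * a : ℝ))) (i n : ℕ) :
    ‖D (i + k * b * n) / i.factorial / (((n.factorial : ℝ) ^ s : ℝ) : ℂ)‖ ≤
      M * ((2 * K * (k * b : ℕ)) ^ (k * b)) ^ (i + n) := by
  have ha0 : (0 : ℝ) < a := by exact_mod_cast ha
  have hk0 : (0 : ℝ) < k := by exact_mod_cast hk
  have hka : (1 : ℝ) ≤ k * a := by exact_mod_cast Nat.mul_pos hk ha
  obtain ⟨c, hc⟩ : ∃ c, c = k * b := ⟨_, rfl⟩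
  have hc0 : 1 ≤ c := hc ▸ Nat.mul_pos hk hb
  have hc1 : (1 : ℝ) ≤ c := by exact_mod_cast hc0
  have hcb : (c : ℝ) / (k * a) = b / a := by
    rw [hc, Nat.cast_mul]; field_simp
  rw [← hc]
  have hi : (1 : ℝ) ≤ i.factorial := by exact_mod_cast i.factorial_pos
  have hn : (1 : ℝ) ≤ n.factorial := by exact_mod_cast n.factorial_pos
  set y : ℝ := 2 ^ (i + c * n) * i.factorial * (c : ℝ) ^ (c * n) with hy
  have hy1 : 1 ≤ y :=
    one_le_mul_of_one_le_of_one_le (one_le_mul_of_one_le_of_one_le (one_le_pow₀ one_le_two) hi)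
      (one_le_pow₀ hc1)
  have h1 : ((i + c * n).factorial : ℝ) ≤ y * (n.factorial : ℝ) ^ c := by
    refine (factorial_add_le_two_pow i (c * n)).trans ?_
    rw [hy, mul_assoc _ ((c : ℝ) ^ (c * n))]
    gcongr
    exact factorial_mul_le_pow c n
  have h2 : ((i + c * n).factorial : ℝ) ^ (1 / (k * a : ℝ)) ≤ y * (n.factorial : ℝ) ^ s := by
    refine (Real.rpow_le_rpow (by positivity) h1 (by positivity)).trans ?_
    rw [Real.mul_rpow (by positivity) (by positivity), ← Real.rpow_natCast_mul (by positivity),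
      mul_one_div, hcb]
    gcongr
    exact (Real.rpow_le_rpow_of_exponent_le hy1
      ((div_le_one (by positivity)).2 hka)).trans_eq (Real.rpow_one y)
  rw [norm_div, norm_div, Complex.norm_natCast, Complex.norm_of_nonneg (by positivity),
    div_le_iff₀ (by positivity), div_le_iff₀ (by positivity)]
  have h3 : 2 * K ≤ (2 * K * c) ^ c :=
    calc 2 * K = 2 * K * 1 := (mul_one _).symm
      _ ≤ 2 * K * c := by gcongr
      _ ≤ _ := le_self_pow₀ (one_le_mul_of_one_le_of_one_le (by linarith) hc1) (by omega)
  calc ‖D (i + c * n)‖ ≤ M * K ^ (i + c * n) * (y * (n.factorial : ℝ) ^ s) := by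
        refine (hD _).trans ?_
        gcongr
    _ = M * ((2 * K) ^ i * ((2 * K * c) ^ c) ^ n) * (n.factorial : ℝ) ^ s * i.factorial := by
        rw [hy, ← pow_mul, mul_pow (2 * K) (c : ℝ), mul_pow, mul_pow, pow_add, pow_add]
        ring
    _ ≤ M * (((2 * K * c) ^ c) ^ i * ((2 * K * c) ^ c) ^ n) * (n.factorial : ℝ) ^ s *
        i.factorial := by gcongr
    _ = _ := by rw [pow_add]

/-- With `θ = x_0 ∂_0` this is `∂_0^l θ = (θ + l) ∂_0^l`; the term `l` moves the parameter of the
`l`-th slice from `β` to `β - l`. -/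
theorem derivBase_pow_theta {d : ℕ} (p : Fin (d + 1) → ℂ) (l : ℕ) (F : FormalGerm p) :
    (derivBase p 0 ^ l) (mulBase p 0 (derivBase p 0 F)) =
      mulBase p 0 (derivBase p 0 ((derivBase p 0 ^ l) F)) + (l : ℂ) • (derivBase p 0 ^ l) F := by
  induction l with
  | zero => simp
  | succ l ih =>
    rw [pow_succ', Module.End.mul_apply, ih, map_add, derivBase_mulBase, map_smul,
      Module.End.mul_apply, Pi.single_eq_same]
    push_cast
    module

/-! ### Slices of a solution and the sequence `D` that encodes it. -/

section SpaceSystem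

variable {L : ℂ → ℂ} {p : Fin 1 → ℂ}

/-- The restriction of `∂_0^l F` to `x_0 = 0`. -/
def slice {d : ℕ} (p : Fin d → ℂ) (l : ℕ) :
    FormalGerm (Fin.cons 0 p : Fin (d + 1) → ℂ) →ₗ[ℂ] FormalGerm p :=
  restrictZero p ∘ₗ (derivBase _ 0 ^ l)

theorem slice_derivBase_pow {d : ℕ} (p : Fin d → ℂ) (l m : ℕ)
    (F : FormalGerm (Fin.cons 0 p : Fin (d + 1) → ℂ)) :
    slice p l ((derivBase _ 0 ^ m) F) = slice p (l + m) F := by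
  rw [slice, slice, pow_add]; rfl

theorem slice_derivBase_succ {d : ℕ} (p : Fin d → ℂ) (i : Fin d) (l : ℕ)
    (F : FormalGerm (Fin.cons 0 p : Fin (d + 1) → ℂ)) :
    slice p l (derivBase _ i.succ F) = derivBase p i (slice p l F) := by
  have h := congrArg (fun T => T F)
    ((commute_derivBase (Fin.cons 0 p : Fin (d + 1) → ℂ) 0 i.succ).pow_left l).eq
  exact (congrArg (restrictZero p) h).trans (restrictZero_derivBase_succ p i _)

theorem slice_derivNormal {d : ℕ} (p : Fin d → ℂ) (l : ℕ)
    (F : FormalGerm (Fin.cons 0 p : Fin (d + 1) → ℂ)) :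
    slice p l (derivNormal _ F) = derivNormal p (slice p l F) := by
  have h := congrArg (fun T => T F)
    ((commute_derivBase_derivNormal (Fin.cons 0 p : Fin (d + 1) → ℂ) 0).pow_left l).eq
  exact (congrArg (restrictZero p) h).trans (restrictZero_derivNormal p _)

theorem slice_mulBase_succ {d : ℕ} (p : Fin d → ℂ) (i : Fin d) (l : ℕ)
    (F : FormalGerm (Fin.cons 0 p : Fin (d + 1) → ℂ)) :
    slice p l (mulBase _ i.succ F) = mulBase p i (slice p l F) := by
  have h := congrArg (fun T => T F)
    ((commute_derivBase_mulBase (Fin.cons 0 p : Fin (d + 1) → ℂ) (Fin.succ_ne_zero i)).pow_left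
      l).eq
  exact (congrArg (restrictZero p) h).trans (restrictZero_mulBase_succ p i _)

theorem slice_mulNormal {d : ℕ} (p : Fin d → ℂ) (l : ℕ)
    (F : FormalGerm (Fin.cons 0 p : Fin (d + 1) → ℂ)) :
    slice p l (mulNormal _ F) = mulNormal p (slice p l F) := by
  have h := congrArg (fun T => T F)
    ((commute_derivBase_mulNormal (Fin.cons 0 p : Fin (d + 1) → ℂ) 0).pow_left l).eq
  exact (congrArg (restrictZero p) h).trans (restrictZero_mulNormal p _)

theorem slice_theta {d : ℕ} (p : Fin d → ℂ) (l : ℕ)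
    (F : FormalGerm (Fin.cons 0 p : Fin (d + 1) → ℂ)) :
    slice p l (mulBase _ 0 (derivBase _ 0 F)) = (l : ℂ) • slice p l F := by
  change restrictZero p ((derivBase _ 0 ^ l) (mulBase _ 0 (derivBase _ 0 F))) = _
  rw [derivBase_pow_theta, map_add, restrictZero_mulBase_zero, zero_add, map_smul]
  rfl

theorem slice_euler (p : Fin 1 → ℂ) (l : ℕ) (m n : ℂ)
    (F : FormalGerm (Fin.cons 0 p : Fin 2 → ℂ)) :
    slice p l (mulBase _ 0 (derivBase _ 0 F) + m • mulBase _ 1 (derivBase _ 1 F) +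
      n • mulNormal _ (derivNormal _ F)) = (l : ℂ) • slice p l F +
        (m • mulBase p 0 (derivBase p 0 (slice p l F)) +
          n • mulNormal p (derivNormal p (slice p l F))) := by
  rw [map_add, map_add, map_smul, map_smul, slice_theta, slice_mulNormal, slice_derivNormal,
    show (1 : Fin 2) = Fin.succ 0 from rfl, slice_mulBase_succ, slice_derivBase_succ, add_assoc]

theorem eulerExp_shift {a k : ℕ} (ha : 1 ≤ a) (hk : 1 ≤ k) (b : ℕ) (β : ℂ) (l n : ℕ) :
    eulerExp a b ((β - l) / k) n = (β - (l + k * b * n : ℕ)) / (k * a : ℕ) := by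
  have ha0 : (a : ℂ) ≠ 0 := by exact_mod_cast (by omega : a ≠ 0)
  have hk0 : (k : ℂ) ≠ 0 := by exact_mod_cast (by omega : k ≠ 0)
  rw [eulerExp]
  push_cast
  field_simp
  ring

theorem exists_slice_eq_mono (hL : IsLogBranch L (p 0)) {a b k : ℕ} (ha : 1 ≤ a) (hk : 1 ≤ k)
    {β : ℂ} {s : ℝ} {F : FormalGerm (Fin.cons 0 p : Fin 2 → ℂ)}
    (hF : F ∈ Sol (Fin.cons 0 p : Fin 2 → ℂ) ![1, k * a, k * b] β s) :
    ∃ D : ℕ → ℂ, (∀ l, D (l + k * a) = (β - l) / (k * a : ℕ) * D l) ∧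
      ∀ l, slice p l F =
        mono hL (eulerExp a b ((β - l) / k)) fun n => D (l + k * b * n) / n.factorial := by
  have hk0 : (k : ℂ) ≠ 0 := by exact_mod_cast (by omega : k ≠ 0)
  obtain ⟨-, ⟨h1, h2⟩, h3⟩ := mem_Sol_three_iff.1 hF
  have h4 : ∀ l, ∃ e, slice p l F = mono hL (eulerExp a b ((β - l) / k)) e := by
    intro l
    refine exists_eq_mono_of_euler hL ha ?_
    have h5 := congrArg (slice p l) h3
    rw [slice_euler, map_smul] at h5
    have h6 : (k : ℂ) • ((a : ℂ) • mulBase p 0 (derivBase p 0 (slice p l F)) +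
        (b : ℂ) • mulNormal p (derivNormal p (slice p l F))) = (β - l) • slice p l F := by
      rw [sub_smul, ← h5, smul_add, smul_smul, smul_smul]
      push_cast
      abel
    rw [div_eq_inv_mul, mul_smul, ← h6, inv_smul_smul₀ hk0]
  choose e he using h4
  -- The slices of `∂_2 = ∂_0^(kb)`: both sides have the same exponents of `x_1`, so constants may
  -- be compared.
  have hN : ∀ l n : ℕ, ((n : ℂ) + 1) * e l (n + 1) = e (l + k * b) n := by
    intro l
    have h5 := congrArg (slice p l) h2
    rw [slice_derivNormal, slice_derivBase_pow, he, he, derivNormal_mono] at h5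
    have h6 : (fun n => eulerExp a b ((β - l) / k) (n + 1)) =
        eulerExp a b ((β - (l + k * b : ℕ)) / k) := by
      funext n
      rw [eulerExp_shift ha hk, eulerExp_shift ha hk]
      congr 3; ring
    rw [h6] at h5
    exact congrFun (mono_injective hL _ h5)
  -- The slices of `∂_1 = ∂_0^(ka)`. Only `n = 0` is needed for the recurrence of `D`.
  have hB : ∀ l n : ℕ, eulerExp a b ((β - l) / k) n * e l n = e (l + k * a) n := by
    intro l
    have h5 := congrArg (slice p l) h1
    rw [show (1 : Fin 2) = Fin.succ 0 from rfl, slice_derivBase_succ, slice_derivBase_pow, he, he,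
      derivBase_mono] at h5
    have h6 : (fun n => eulerExp a b ((β - l) / k) n - 1) =
        eulerExp a b ((β - (l + k * a : ℕ)) / k) := by
      have hka0 : ((k * a : ℕ) : ℂ) ≠ 0 := by
        exact_mod_cast (Nat.mul_pos hk ha).ne'
      funext n
      rw [eulerExp_shift ha hk, eulerExp_shift ha hk, div_sub_one hka0]
      push_cast
      congr 1
      ring
    rw [h6] at h5
    exact congrFun (mono_injective hL _ h5)
  refine ⟨fun l => e l 0, fun l => ?_, fun l => ?_⟩
  · have h7 := hB l 0
    rw [eulerExp_shift ha hk, mul_zero, add_zero] at h7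
    exact h7.symm
  · rw [he]
    congr 1
    funext n
    induction n generalizing l with
    | zero => simp
    | succ n ih =>
      have h7 : (n : ℂ) + 1 ≠ 0 := by exact_mod_cast n.succ_ne_zero
      have h8 := hN l n
      rw [ih (l + k * b)] at h8
      rw [eq_div_of_mul_eq h7 ((mul_comm _ _).trans h8), Nat.factorial_succ, div_div,
        show l + k * b + k * b * n = l + k * b * (n + 1) by ring]
      push_cast
      congr 1
      ring

end SpaceSystem

/-! ### Construction of a solution from a sequence `D`. -/

section Existence

variable {L : ℂ → ℂ} {p : Fin 1 → ℂ}

/-- The coefficients of the `l`-th derivative in `x_0` of the solution with data `D`: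
`∑_{n,i} D_{l+i+kbn} x_0^i x_1^((β-l-i-kbn)/(ka)) x_2^n / (i! n!)`. -/
def solFamily (a b k : ℕ) (β : ℂ) (L : ℂ → ℂ) (D : ℕ → ℂ) (l : ℕ) (y : Fin 2 → ℂ) (n : ℕ) : ℂ :=
  Complex.exp (eulerExp a b ((β - l) / k) n * L (y 1)) *
    expGen D (l + k * b * n) (y 0 * Complex.exp (-(1 / (k * a : ℕ)) * L (y 1))) / n.factorial

theorem tendsto_coord_one (p : Fin 1 → ℂ) :
    Tendsto (fun y : Fin 2 → ℂ => y 1) (𝓝 (Fin.cons 0 p)) (𝓝 (p 0)) :=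
  (continuous_apply (1 : Fin 2)).continuousAt

theorem analyticAt_coord_mul_exp {y : Fin 2 → ℂ} (hy : AnalyticAt ℂ L (y 1)) (c : ℂ) :
    AnalyticAt ℂ (fun y : Fin 2 → ℂ => y 0 * Complex.exp (c * L (y 1))) y :=
  have h : AnalyticAt ℂ (fun y : Fin 2 → ℂ => L (y 1)) y :=
    AnalyticAt.fun_comp hy (analyticAt_coord 1 y)
  (analyticAt_coord 0 y).mul (analyticAt_const.mul h).cexp'

theorem eventually_small (hL : IsLogBranch L (p 0)) (c : ℂ) {r : ℝ} (hr : 0 < r) :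
    ∀ᶠ y : Fin 2 → ℂ in 𝓝 (Fin.cons 0 p),
      AnalyticAt ℂ L (y 1) ∧ ‖y 0 * Complex.exp (c * L (y 1))‖ < r := by
  refine ((tendsto_coord_one p).eventually hL.1.eventually_analyticAt).and ?_
  have h1 := (analyticAt_coord_mul_exp (L := L) (y := (Fin.cons 0 p : Fin 2 → ℂ)) hL.1
    c).continuousAt
  refine h1.norm.eventually_lt continuousAt_const ?_
  simpa using hr

theorem holAlong_solFamily (hL : IsLogBranch L (p 0)) (a b k : ℕ) (β : ℂ) {D : ℕ → ℂ} {M K : ℝ}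
    (hM : 0 ≤ M) (hK : 1 ≤ K) (hD : ∀ n, ‖D n‖ ≤ M * K ^ n * n.factorial) (l : ℕ) :
    HolAlong (Fin.cons 0 p : Fin 2 → ℂ) (solFamily a b k β L D l) := by
  filter_upwards [eventually_small hL (-(1 / (k * a : ℕ))) (r := 1 / (4 * K)) (by positivity)]
    with y hy n
  have h1 : AnalyticAt ℂ (fun y : Fin 2 → ℂ => L (y 1)) y :=
    AnalyticAt.fun_comp hy.1 (analyticAt_coord 1 y)
  exact ((analyticAt_const.mul h1).cexp'.mul
    (AnalyticAt.fun_comp (analyticAt_expGen hM hK hD _ hy.2)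
      (analyticAt_coord_mul_exp hy.1 _))).div_const

theorem derivBase_solFamily (hL : IsLogBranch L (p 0)) {a b k : ℕ} (ha : 1 ≤ a) (hk : 1 ≤ k)
    (β : ℂ) {D : ℕ → ℂ} {M K : ℝ} (hM : 0 ≤ M) (hK : 1 ≤ K)
    (hD : ∀ n, ‖D n‖ ≤ M * K ^ n * n.factorial) (l : ℕ) :
    derivBase (Fin.cons 0 p : Fin 2 → ℂ) 0
      (FormalGerm.mk _ (holAlong_solFamily hL a b k β hM hK hD l)) =
        FormalGerm.mk _ (holAlong_solFamily hL a b k β hM hK hD (l + 1)) := by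
  refine Subtype.ext (Germ.coe_eq.2 ?_)
  filter_upwards [eventually_small hL (-(1 / (k * a : ℕ))) (r := 1 / (4 * K)) (by positivity),
    holAlong_solFamily hL a b k β hM hK hD l] with y hy hy'
  funext n
  set W := Complex.exp (-(1 / (k * a : ℕ)) * L (y 1)) with hW
  have h1 : HasLineDerivAt ℂ (fun z => solFamily a b k β L D l z n)
      (solFamily a b k β L D (l + 1) y n) y (Pi.single 0 1) := by
    have h2 : HasDerivAt (fun t : ℂ => (y 0 + t) * W) W 0 := by
      simpa using ((hasDerivAt_id' (0 : ℂ)).const_add (y 0)).mul_const W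
    have h3 : HasDerivAt (expGen D (l + k * b * n)) (expGen D (l + k * b * n + 1) (y 0 * W))
        ((y 0 + 0) * W) := by
      rw [add_zero]; exact hasDerivAt_expGen hM hK hD _ hy.2
    have h4 := ((h3.comp (0 : ℂ) h2).const_mul
      (Complex.exp (eulerExp a b ((β - l) / k) n * L (y 1)))).div_const (n.factorial : ℂ)
    have h5 : solFamily a b k β L D (l + 1) y n =
        Complex.exp (eulerExp a b ((β - l) / k) n * L (y 1)) *
          (expGen D (l + k * b * n + 1) (y 0 * W) * W) / n.factorial := by
      -- The chain rule produces the factor `W = x_1^(-1/(ka))`, exactly the change of exponent from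
      -- `l` to `l + 1`.
      have h6 : Complex.exp (eulerExp a b ((β - (l + 1 : ℕ)) / k) n * L (y 1)) =
          Complex.exp (eulerExp a b ((β - l) / k) n * L (y 1)) * W := by
        have hka0 : ((k * a : ℕ) : ℂ) ≠ 0 := by exact_mod_cast (Nat.mul_pos hk ha).ne'
        rw [hW, ← Complex.exp_add, eulerExp_shift ha hk, eulerExp_shift ha hk]
        congr 1
        push_cast at hka0 ⊢
        field_simp
        ring
      rw [solFamily, h6, ← hW, show l + 1 + k * b * n = l + k * b * n + 1 by ring]
      ring
    rw [h5]
    refine h4.congr_of_eventuallyEq (Eventually.of_forall fun t => ?_)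
    simp [solFamily, hW]
  have h2 := (hy' n).differentiableAt.lineDeriv_eq_fderiv (v := Pi.single 0 1)
  rw [h1.lineDeriv] at h2
  exact h2.symm

theorem derivBase_pow_solFamily (hL : IsLogBranch L (p 0)) {a b k : ℕ} (ha : 1 ≤ a) (hk : 1 ≤ k)
    (β : ℂ) {D : ℕ → ℂ} {M K : ℝ} (hM : 0 ≤ M) (hK : 1 ≤ K)
    (hD : ∀ n, ‖D n‖ ≤ M * K ^ n * n.factorial) (l : ℕ) :
    (derivBase (Fin.cons 0 p : Fin 2 → ℂ) 0 ^ l)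
      (FormalGerm.mk _ (holAlong_solFamily hL a b k β hM hK hD 0)) =
        FormalGerm.mk _ (holAlong_solFamily hL a b k β hM hK hD l) := by
  induction l with
  | zero => rfl
  | succ l ih =>
    rw [pow_succ', Module.End.mul_apply, ih, derivBase_solFamily hL ha hk β hM hK hD]

theorem slice_solFamily (hL : IsLogBranch L (p 0)) {a b k : ℕ} (ha : 1 ≤ a) (hk : 1 ≤ k)
    (β : ℂ) {D : ℕ → ℂ} {M K : ℝ} (hM : 0 ≤ M) (hK : 1 ≤ K)
    (hD : ∀ n, ‖D n‖ ≤ M * K ^ n * n.factorial) (l : ℕ) :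
    slice p l (FormalGerm.mk _ (holAlong_solFamily hL a b k β hM hK hD 0)) =
      mono hL (eulerExp a b ((β - l) / k)) fun n => D (l + k * b * n) / n.factorial := by
  rw [slice, LinearMap.comp_apply, derivBase_pow_solFamily hL ha hk β hM hK hD]
  refine Subtype.ext (Germ.coe_eq.2 (Eventually.of_forall fun y => ?_))
  funext n
  change solFamily a b k β L D l (Fin.cons 0 y) n =
    D (l + k * b * n) / n.factorial * Complex.exp (eulerExp a b ((β - l) / k) n * L (y 0))
  rw [solFamily, Fin.cons_zero, zero_mul, expGen_zero]
  change Complex.exp (eulerExp a b ((β - l) / k) n * L (y 0)) * _ / _ = _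
  ring

theorem solFamily_mem_Gevrey (hL : IsLogBranch L (p 0)) {a b k : ℕ} (ha : 1 ≤ a) (hb : 1 ≤ b)
    (hk : 1 ≤ k) (β : ℂ) {s : ℝ} (hs : (b : ℝ) / a ≤ s) {D : ℕ → ℂ} {M K : ℝ}
    (hM : 0 ≤ M) (hK : 1 ≤ K) (hD : ∀ n, ‖D n‖ ≤ M * K ^ n * n.factorial)
    (hD' : ∀ n, ‖D n‖ ≤ M * K ^ n * (n.factorial : ℝ) ^ (1 / (k * a : ℝ))) :
    FormalGerm.mk _ (holAlong_solFamily hL a b k β hM hK hD 0) ∈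
      Gevrey (Fin.cons 0 p : Fin 2 → ℂ) s := by
  have hL1 : AnalyticAt ℂ (fun y : Fin 2 → ℂ => L (y 1)) (Fin.cons 0 p) :=
    AnalyticAt.fun_comp (g := L) hL.1 (analyticAt_coord 1 _)
  have hkb : (0 : ℝ) < (k * b : ℕ) := by exact_mod_cast Nat.mul_pos hk hb
  -- The series is `x_1^(β/(ka)) G(x_0 x_1^(-1/(ka)), x_1^(-b/a) x_2)` for one two-variable series
  -- `G`.
  refine mk_mem_Gevrey _
    (c := fun i n => D (i + k * b * n) / i.factorial / (((n.factorial : ℝ) ^ s : ℝ) : ℂ))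
    (norm_div_factorial_rpow_le ha hb hk hM hK hs hD') hM (by positivity)
    (A := fun y => Complex.exp (β / (k * a : ℕ) * L (y 1)))
    (U := fun y => y 0 * Complex.exp (-(1 / (k * a : ℕ)) * L (y 1)))
    (V := fun y => Complex.exp (-((k * b : ℕ) / (k * a : ℕ)) * L (y 1)))
    (analyticAt_const.mul hL1).cexp' (analyticAt_coord_mul_exp hL.1 _)
    (analyticAt_const.mul hL1).cexp' (by simp) (Eventually.of_forall fun y n => ?_)
  have h4 : (((n.factorial : ℝ) ^ (s - 1) : ℝ) : ℂ) ≠ 0 := by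
    rw [Complex.ofReal_ne_zero]; positivity
  have h5 : (n.factorial : ℂ) ≠ 0 := Nat.cast_ne_zero.2 n.factorial_ne_zero
  set u := y 0 * Complex.exp (-(1 / (k * a : ℕ)) * L (y 1)) with hu
  have h6 : Complex.exp (eulerExp a b ((β - (0 : ℕ)) / k) n * L (y 1)) =
      Complex.exp (β / (k * a : ℕ) * L (y 1)) *
        Complex.exp (-((k * b : ℕ) / (k * a : ℕ)) * L (y 1)) ^ n := by
    rw [← Complex.exp_nat_mul, ← Complex.exp_add, eulerExp_shift ha hk]
    congr 1
    push_cast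
    ring
  have h7 : ∑' i : ℕ, D (i + k * b * n) / i.factorial / (((n.factorial : ℝ) ^ s : ℝ) : ℂ) * u ^ i =
      expGen D (k * b * n) u / (((n.factorial : ℝ) ^ s : ℝ) : ℂ) := by
    rw [expGen, ← tsum_div_const]
    exact tsum_congr fun i => by ring
  rw [h7, ← ofReal_rpow_sub_one_mul_factorial n s, solFamily, ← hu, h6, zero_add]
  field_simp

theorem exists_mem_Sol_slice (hL : IsLogBranch L (p 0)) {a b k : ℕ} (ha : 1 ≤ a) (hb : 1 ≤ b)
    (hk : 1 ≤ k) {β : ℂ} {s : ℝ} (hs : (b : ℝ) / a ≤ s) {D : ℕ → ℂ}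
    (hD : ∀ l, D (l + k * a) = (β - l) / (k * a : ℕ) * D l) :
    ∃ F ∈ Sol (Fin.cons 0 p : Fin 2 → ℂ) ![1, k * a, k * b] β s,
      ∀ l, slice p l F =
        mono hL (eulerExp a b ((β - l) / k)) fun n => D (l + k * b * n) / n.factorial := by
  have hka : 1 ≤ k * a := Nat.mul_pos hk ha
  have hk0 : (k : ℂ) ≠ 0 := by exact_mod_cast (by omega : k ≠ 0)
  have hka0 : ((k * a : ℕ) : ℂ) ≠ 0 := by exact_mod_cast (by omega : k * a ≠ 0)
  have hka1 : (1 : ℝ) ≤ (k * a : ℕ) := by exact_mod_cast hka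
  obtain ⟨M, K, hM, hK, hE⟩ := exists_bound_of_recurrence (b := 1) hka (C := ‖β‖ + 1) (E := D) (by
    intro n
    rw [hD n, norm_mul, norm_div, Complex.norm_natCast, pow_one]
    gcongr
    refine (div_le_self (norm_nonneg _) hka1).trans ((norm_sub_le _ _).trans ?_)
    rw [Complex.norm_natCast]
    nlinarith [mul_nonneg (norm_nonneg β) (Nat.cast_nonneg n : (0 : ℝ) ≤ n)])
  have hE' : ∀ n, ‖D n‖ ≤ M * K ^ n * (n.factorial : ℝ) ^ (1 / (k * a : ℝ)) := by
    simpa using hE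
  have hE1 : ∀ n, ‖D n‖ ≤ M * K ^ n * n.factorial := by
    intro n
    refine (hE' n).trans ?_
    gcongr
    have hn : (1 : ℝ) ≤ n.factorial := by exact_mod_cast n.factorial_pos
    refine (Real.rpow_le_rpow_of_exponent_le hn ?_).trans_eq (Real.rpow_one _)
    rw [div_le_one (by exact_mod_cast hka)]
    exact_mod_cast hka
  set F := FormalGerm.mk _ (holAlong_solFamily hL a b k β hM hK hE1 0) with hFdef
  have hsl : ∀ l, slice p l F =
      mono hL (eulerExp a b ((β - l) / k)) fun n => D (l + k * b * n) / n.factorial :=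
    slice_solFamily hL ha hk β hM hK hE1
  refine ⟨F, mem_Sol_three_iff.2 ⟨solFamily_mem_Gevrey hL ha hb hk β hs hM hK hE1 hE', ⟨?_, ?_⟩,
    ?_⟩, hsl⟩
  -- The equation for `∂_1`, and below the Euler equation, are verified on slices, which avoids
  -- differentiating the double series in `x_1`.
  · refine sub_eq_zero.1 (eq_zero_of_restrictZero_derivBase_pow fun l => ?_)
    change slice p l _ = 0
    rw [map_sub, sub_eq_zero, show (1 : Fin 2) = Fin.succ 0 from rfl, slice_derivBase_succ,
      slice_derivBase_pow, hsl, hsl, derivBase_mono]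
    congr 2
    · funext n
      rw [eulerExp_shift ha hk, eulerExp_shift ha hk, div_sub_one hka0]
      push_cast
      congr 1
      ring
    · funext n
      rw [eulerExp_shift ha hk, show l + k * a + k * b * n = l + k * b * n + k * a by ring, hD]
      ring
  · rw [hFdef, derivBase_pow_solFamily hL ha hk β hM hK hE1]
    refine Subtype.ext (Germ.coe_eq.2 (Eventually.of_forall fun y => ?_))
    funext n
    change ((n : ℂ) + 1) * solFamily a b k β L D 0 y (n + 1) = solFamily a b k β L D (k * b) y n
    have h1 : (n : ℂ) + 1 ≠ 0 := by exact_mod_cast n.succ_ne_zero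
    have h2 : (n.factorial : ℂ) ≠ 0 := Nat.cast_ne_zero.2 n.factorial_ne_zero
    rw [solFamily, solFamily, eulerExp_shift ha hk, eulerExp_shift ha hk, Nat.factorial_succ,
      show 0 + k * b * (n + 1) = k * b + k * b * n by ring]
    push_cast
    field_simp
  · refine sub_eq_zero.1 (eq_zero_of_restrictZero_derivBase_pow fun l => ?_)
    change slice p l _ = 0
    have h3 := euler_mono hL ha b ((β - l) / k) fun n => D (l + k * b * n) / n.factorial
    have h4 := congrArg (fun G => (k : ℂ) • G) h3
    rw [smul_add, smul_smul, smul_smul, smul_smul, mul_div_cancel₀ _ hk0] at h4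
    rw [map_sub, sub_eq_zero, slice_euler, map_smul, hsl, Nat.cast_mul, Nat.cast_mul, h4,
      ← add_smul, add_sub_cancel]

end Existence

/-! ### Arithmetic of the exponents -/

theorem add_mul_mod_mul {k r : ℕ} (hr : r < k) (a c : ℕ) :
    (r + k * c) % (k * a) = r + k * (c % a) := by
  rw [Nat.mod_mul, Nat.add_mul_mod_self_left, Nat.mod_eq_of_lt hr,
    Nat.add_mul_div_left _ _ (by omega), Nat.div_eq_of_lt hr, zero_add]

theorem add_mul_mod_eq_iff {k r r' : ℕ} (hr : r < k) (hr' : r' < k) (a c c' : ℕ) :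
    (r + k * c) % (k * a) = (r' + k * c') % (k * a) ↔ r = r' ∧ c % a = c' % a := by
  rw [add_mul_mod_mul hr, add_mul_mod_mul hr']
  constructor
  · intro h
    have h1 : r = r' := by
      have := congrArg (· % k) h
      simpa [Nat.add_mul_mod_self_left, Nat.mod_eq_of_lt hr, Nat.mod_eq_of_lt hr'] using this
    subst h1
    exact ⟨rfl, Nat.eq_of_mul_eq_mul_left (by omega) (Nat.add_left_cancel h)⟩
  · rintro ⟨rfl, h⟩
    rw [h]

theorem eq_of_mul_mod_eq {a b : ℕ} (hab : Nat.Coprime a b) {m n : Fin a}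
    (h : b * m % a = b * n % a) : m = n := by
  have h1 : (m : ℕ) % a = n % a := Nat.ModEq.cancel_left_of_coprime hab h
  rw [Nat.mod_eq_of_lt m.2, Nat.mod_eq_of_lt n.2] at h1
  exact Fin.ext h1

/-- The residue modulo `ka` of the exponent `ℓ + kbn`. -/
def expResidue (a b k : ℕ) (i : Fin k × Fin a) : ℕ := (i.1 + k * b * i.2) % (k * a)

theorem expResidue_eq_iff {a b k : ℕ} (hab : Nat.Coprime a b) {i j : Fin k × Fin a} :
    (j.1 + k * b * j.2) % (k * a) = expResidue a b k i ↔ j = i := by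
  constructor
  · intro h
    rw [expResidue, mul_assoc, mul_assoc, add_mul_mod_eq_iff j.1.2 i.1.2] at h
    exact Prod.ext (Fin.ext h.1) (eq_of_mul_mod_eq hab h.2)
  · rintro rfl; rfl

/-- An injective map between sets of cardinality `ka` is onto. -/
theorem exists_expResidue_eq {a b k : ℕ} (hab : Nat.Coprime a b) {ρ : ℕ} (hρ : ρ < k * a) :
    ∃ i, expResidue a b k i = ρ := by
  let f : Fin k × Fin a → Fin (k * a) := fun i => ⟨expResidue a b k i, Nat.mod_lt _ (by omega)⟩
  have hf : Function.Bijective f := by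
    rw [Fintype.bijective_iff_injective_and_card]
    refine ⟨fun i j h => (expResidue_eq_iff hab).1 (Fin.ext_iff.1 h), by simp⟩
  obtain ⟨i, hi⟩ := hf.2 ⟨ρ, hρ⟩
  exact ⟨i, Fin.ext_iff.1 hi⟩

/-- The ratio of the coefficient of index `l` of a solution to the one of index `l % κ`. -/
def weight (κ : ℕ) (β : ℂ) (l : ℕ) : ℂ := poch ((β - (l % κ : ℕ)) / κ) (l / κ)

theorem weight_of_lt {κ l : ℕ} (β : ℂ) (h : l < κ) : weight κ β l = 1 := by
  rw [weight, Nat.div_eq_of_lt h, poch_zero]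

theorem weight_add {κ : ℕ} (hκ : 0 < κ) (β : ℂ) (l : ℕ) :
    weight κ β (l + κ) = (β - l) / κ * weight κ β l := by
  have hκ0 : (κ : ℂ) ≠ 0 := by exact_mod_cast hκ.ne'
  have h1 : (l : ℂ) = (l % κ : ℕ) + κ * (l / κ : ℕ) := by exact_mod_cast (Nat.mod_add_div l κ).symm
  rw [weight, weight, Nat.add_mod_right, Nat.add_div_right l hκ, poch_succ, h1]
  field_simp
  ring

theorem weight_eq_zero_iff {κ : ℕ} (hκ : 0 < κ) (β : ℂ) (l : ℕ) :
    weight κ β l = 0 ↔ ∃ N : ℕ, β = N ∧ N < l ∧ N % κ = l % κ := by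
  have hκ0 : (κ : ℂ) ≠ 0 := by exact_mod_cast hκ.ne'
  rw [weight, poch_eq_zero_iff]
  constructor
  · rintro ⟨i, hi, h⟩
    refine ⟨l % κ + κ * i, ?_, ?_, ?_⟩
    · rw [div_eq_iff hκ0] at h
      push_cast
      linear_combination h
    · calc l % κ + κ * i < l % κ + κ * (l / κ) := by gcongr
        _ = l := Nat.mod_add_div l κ
    · simp
  · rintro ⟨N, rfl, hN, h⟩
    refine ⟨N / κ, ?_, ?_⟩
    · by_contra! hle
      have h1 := Nat.mod_add_div N κ
      have h2 := Nat.mod_add_div l κ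
      have h3 : κ * (l / κ) ≤ κ * (N / κ) := by gcongr
      omega
    · rw [div_eq_iff hκ0, ← h]
      have : (N : ℂ) = (N % κ : ℕ) + κ * (N / κ : ℕ) := by
        exact_mod_cast (Nat.mod_add_div N κ).symm
      linear_combination this

theorem apply_add_mul {κ : ℕ} (hκ : 0 < κ) {β : ℂ} {D : ℕ → ℂ}
    (hD : ∀ l, D (l + κ) = (β - l) / κ * D l) (l q : ℕ) :
    D (l + κ * q) = poch ((β - l) / κ) q * D l := by
  have hκ0 : (κ : ℂ) ≠ 0 := by exact_mod_cast hκ.ne'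
  induction q with
  | zero => simp [poch_zero]
  | succ q ih =>
    rw [mul_add_one, ← add_assoc, hD, ih, poch_succ]
    push_cast
    field_simp
    ring

theorem apply_eq_weight_mul {κ : ℕ} (hκ : 0 < κ) {β : ℂ} {D : ℕ → ℂ}
    (hD : ∀ l, D (l + κ) = (β - l) / κ * D l) (l : ℕ) : D l = weight κ β l * D (l % κ) := by
  rw [weight, ← apply_add_mul hκ hD, Nat.mod_add_div]

theorem recurrence_of_slice {a b k : ℕ} (ha : 1 ≤ a) (hk : 1 ≤ k) {β : ℂ} {D : ℕ → ℂ}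
    (hD : ∀ l, D (l + k * a) = (β - l) / (k * a : ℕ) * D l) (l n : ℕ) :
    poch (eulerExp a b ((β - l) / k) n) b * (n.factorial * (D (l + k * b * n) / n.factorial)) =
      (n + a).factorial * (D (l + k * b * (n + a)) / (n + a).factorial) := by
  rw [mul_div_cancel₀ _ (Nat.cast_ne_zero.2 (Nat.factorial_ne_zero _)),
    mul_div_cancel₀ _ (Nat.cast_ne_zero.2 (Nat.factorial_ne_zero _)), eulerExp_shift ha hk,
    ← apply_add_mul (Nat.mul_pos hk ha) hD]
  congr 1
  ring

/-- If `xa + yb` lies in the class of `bn` modulo `a`, then `y ≡ n`, so `y ≥ n` because `n < a`.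
Hence `bn` is the least element of `ℕA` in its class, and the larger elements of the class arise by
adding multiples of `a`. -/
theorem lt_mul_iff_notMem_semigroup {a b : ℕ} (hab : Nat.Coprime a b) {c n : ℕ} (hn : n < a)
    (h : c % a = b * n % a) : c < b * n ↔ c ∉ semigroup a b := by
  rw [semigroup, AddSubmonoid.mem_closure_pair]
  constructor
  · rintro hlt ⟨x, y, rfl⟩
    have h1 : b * y % a = b * n % a := by
      rw [← h, smul_eq_mul, smul_eq_mul, mul_comm x, Nat.mul_add_mod, mul_comm]
    have h2 : y % a = n % a := Nat.ModEq.cancel_left_of_coprime hab h1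
    rw [Nat.mod_eq_of_lt hn] at h2
    have h3 : n ≤ y := h2 ▸ Nat.mod_le y a
    have h4 : b * n ≤ b * y := Nat.mul_le_mul_left b h3
    rw [smul_eq_mul, smul_eq_mul, mul_comm y] at hlt
    have := Nat.zero_le (x * a)
    omega
  · intro hc
    by_contra! hle
    obtain ⟨t, ht⟩ := (Nat.modEq_iff_dvd' hle).1 (Eq.symm h)
    exact hc ⟨t, n, by rw [smul_eq_mul, smul_eq_mul, mul_comm t, mul_comm n]; omega⟩

theorem weight_eq_zero_iff_of_natCast {a b k : ℕ} (hab : Nat.Coprime a b) {β : ℂ} {r c : ℕ}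
    (hr : r < k) (hβ : β = (r : ℂ) + k * c) (i : Fin k × Fin a) :
    weight (k * a) β (i.1 + k * b * i.2) = 0 ↔
      c ∉ semigroup a b ∧ (i.1 : ℕ) = r ∧ b * i.2 ≡ c [MOD a] := by
  have hka : 0 < k * a := Nat.mul_pos (by omega) (by have := i.2.2; omega)
  obtain rfl : β = ((r + k * c : ℕ) : ℂ) := by rw [hβ]; push_cast; rfl
  rw [weight_eq_zero_iff hka, mul_assoc]
  constructor
  · rintro ⟨N, h1, h2, h3⟩
    obtain rfl := Nat.cast_injective h1
    rw [add_mul_mod_eq_iff hr i.1.2] at h3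
    refine ⟨(lt_mul_iff_notMem_semigroup hab i.2.2 h3.2).1 ?_, h3.1.symm, h3.2.symm⟩
    rw [h3.1] at h2
    exact Nat.lt_of_mul_lt_mul_left (Nat.lt_of_add_lt_add_left h2)
  · rintro ⟨h1, rfl, h3⟩
    refine ⟨_, rfl, ?_, (add_mul_mod_eq_iff hr i.1.2 _ _ _).2 ⟨rfl, h3.symm⟩⟩
    have h4 := (lt_mul_iff_notMem_semigroup hab i.2.2 h3.symm).2 h1
    have h5 : k * c < k * (b * i.2) := Nat.mul_lt_mul_of_pos_left h4 (by omega)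
    omega

theorem isExceptional_iff {a b k : ℕ} (ha : 1 ≤ a) {β : ℂ} {r : Fin k} {c : ℕ}
    (hβ : β = ((r : ℕ) : ℂ) + k * c) (j₀ : ℕ) (r₀ : Fin k) (q₀ : ℕ) (h : ℤ) (j₀' : Fin a) :
    IsExceptional a b k β j₀ r₀ q₀ h j₀' ↔
      j₀ = r + k * (c % a) ∧ r₀ = r ∧ q₀ = c % a ∧ h = (c / a : ℕ) ∧ b * j₀' ≡ c [MOD a] := by
  have hk : 0 < k := by have := r.2; omega
  constructor
  · rintro ⟨h1, h2, h3, h4⟩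
    have h5 : j₀ = r₀ + k * q₀ := by
      have : (j₀ : ℂ) = (r₀ : ℕ) + k * q₀ := by linear_combination h3 - h2
      exact_mod_cast this
    have h6 : ((r₀ : ℕ) : ℤ) + k * (q₀ + a * h) = (r : ℕ) + k * c := by
      have : ((r₀ : ℕ) : ℂ) + k * (q₀ + a * h) = (r : ℕ) + k * c := by
        linear_combination hβ - h3
      exact_mod_cast this
    -- Reduction modulo `k` isolates `r₀`; uniqueness of Euclidean division of `c` by `a` then fixes
    -- `q₀` and `h`.
    have h7 : ((r₀ : ℕ) : ℤ) = (r : ℕ) := by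
      have h8 := congrArg (· % (k : ℤ)) h6
      simp only [Int.add_mul_emod_self_left] at h8
      rwa [Int.emod_eq_of_lt (by positivity) (by exact_mod_cast r₀.2),
        Int.emod_eq_of_lt (by positivity) (by exact_mod_cast r.2)] at h8
    have h8 : (q₀ : ℤ) + a * h = c := by
      rw [h7] at h6
      exact mul_left_cancel₀ (by exact_mod_cast hk.ne' : (k : ℤ) ≠ 0) (add_left_cancel h6)
    have h9 : q₀ < a := by
      refine Nat.lt_of_mul_lt_mul_left (a := k) ?_
      omega
    have h10 := (Int.ediv_emod_unique (a := (c : ℤ)) (b := (a : ℤ)) (r := (q₀ : ℤ)) (q := h)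
      (by exact_mod_cast ha)).2 ⟨h8, by positivity, by exact_mod_cast h9⟩
    have h11 : q₀ = c % a := by exact_mod_cast h10.2.symm
    have h12 : r₀ = r := Fin.ext (by exact_mod_cast h7)
    refine ⟨by rw [h5, h12, h11], h12, h11, by rw [← h10.1]; push_cast; rfl, ?_⟩
    rw [h11] at h4
    exact h4.trans (Nat.mod_modEq c a)
  · rintro ⟨rfl, rfl, rfl, rfl, h1⟩
    have h2 : (c : ℂ) = (c % a : ℕ) + a * (c / a : ℕ) := by
      exact_mod_cast (Nat.mod_add_div c a).symm
    refine ⟨?_, ?_, ?_, h1.trans (Nat.mod_modEq c a).symm⟩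
    · rw [← add_mul_mod_mul r₀.2]
      exact Nat.mod_lt _ (Nat.mul_pos hk ha)
    · rw [hβ, h2, Int.cast_natCast]; push_cast; ring
    · rw [hβ, h2, Int.cast_natCast]; ring

theorem existsUnique_isExceptional {a b k : ℕ} (ha : 1 ≤ a) (hab : Nat.Coprime a b) {β : ℂ}
    {r : Fin k} {c : ℕ} (hβ : β = ((r : ℕ) : ℂ) + k * c) :
    ∃! t : ℕ × Fin k × ℕ × ℤ × Fin a,
      IsExceptional a b k β t.1 t.2.1 t.2.2.1 t.2.2.2.1 t.2.2.2.2 := by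
  simp only [isExceptional_iff ha hβ]
  have hk : 0 < k := by have := r.2; omega
  obtain ⟨i, hi⟩ := exists_expResidue_eq (b := b) hab
    (Nat.mod_lt (r + k * c) (Nat.mul_pos hk ha))
  rw [expResidue, mul_assoc, add_mul_mod_eq_iff i.1.2 r.2] at hi
  refine ⟨⟨_, r, _, _, i.2⟩, ⟨rfl, rfl, rfl, rfl, hi.2⟩, ?_⟩
  rintro ⟨j₀, r₀, q₀, h, j'⟩ ht
  obtain ⟨h1, h2, h3, h4, h5⟩ :
    j₀ = r + k * (c % a) ∧ r₀ = r ∧ q₀ = c % a ∧ h = (c / a : ℕ) ∧ b * j' ≡ c [MOD a] := ht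
  rw [h1, h2, h3, h4, eq_of_mul_mod_eq hab (Eq.trans h5 hi.2.symm)]

/-! ### Diagonal linear maps -/

theorem bijective_of_diagonal {ι V W : Type*} [AddCommGroup V] [Module ℂ V]
    [AddCommGroup W] [Module ℂ W] (f : V →ₗ[ℂ] W) (v : Module.Basis ι ℂ V)
    (w : Module.Basis ι ℂ W) {c : ι → ℂ} (hf : ∀ i, f (v i) = c i • w i) (hc : ∀ i, c i ≠ 0) :
    Function.Bijective f := by
  have h : f = (v.equiv (w.unitsSMul fun i => Units.mk0 (c i) (hc i)) (Equiv.refl ι)).toLinearMap :=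
    v.ext fun i => by
      rw [hf, LinearEquiv.coe_coe, Module.Basis.equiv_apply, Module.Basis.unitsSMul_apply]
      rfl
  rw [h]
  exact LinearEquiv.bijective _

theorem range_of_diagonal {ι V W : Type*} [AddCommGroup V] [Module ℂ V]
    [AddCommGroup W] [Module ℂ W] (f : V →ₗ[ℂ] W) (v : Module.Basis ι ℂ V)
    (w : Module.Basis ι ℂ W) {c : ι → ℂ} (hf : ∀ i, f (v i) = c i • w i) {i₀ : ι}
    (hc : ∀ i, c i = 0 ↔ i = i₀) :
    LinearMap.range f = Submodule.span ℂ (Set.range fun i : {i // i ≠ i₀} => w i) := by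
  rw [LinearMap.range_eq_map, ← v.span_eq, Submodule.map_span]
  refine le_antisymm (Submodule.span_le.2 ?_) (Submodule.span_le.2 ?_)
  · rintro _ ⟨_, ⟨i, rfl⟩, rfl⟩
    rw [hf]
    by_cases hi : i = i₀
    · rw [(hc i).2 hi, zero_smul]; exact zero_mem _
    · exact Submodule.smul_mem _ _ (Submodule.subset_span ⟨⟨i, hi⟩, rfl⟩)
  · rintro _ ⟨⟨i, hi⟩, rfl⟩
    have hci : c i ≠ 0 := fun h => hi ((hc i).1 h)
    change w i ∈ _
    rw [← inv_smul_smul₀ hci (w i), ← hf]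
    exact Submodule.smul_mem _ _ (Submodule.subset_span ⟨_, ⟨i, rfl⟩, rfl⟩)

theorem finrank_quotient_range_of_diagonal {ι V W : Type*} [Fintype ι] [DecidableEq ι]
    [AddCommGroup V] [Module ℂ V] [AddCommGroup W] [Module ℂ W] (f : V →ₗ[ℂ] W)
    (v : Module.Basis ι ℂ V) (w : Module.Basis ι ℂ W) {c : ι → ℂ}
    (hf : ∀ i, f (v i) = c i • w i) {i₀ : ι} (hc : ∀ i, c i = 0 ↔ i = i₀) :
    Module.finrank ℂ (W ⧸ LinearMap.range f) = 1 := by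
  have := Module.Finite.of_basis w
  have h1 := (LinearMap.range f).finrank_quotient_add_finrank
  have h2 : Module.finrank ℂ (LinearMap.range f) = Fintype.card {i // i ≠ i₀} := by
    rw [range_of_diagonal f v w hf hc]
    exact finrank_span_eq_card (w.linearIndependent.comp _ Subtype.val_injective)
  rw [h2, Module.finrank_eq_card_basis w, Fintype.card_subtype_compl,
    Fintype.card_subtype_eq] at h1
  have : 0 < Fintype.card ι := Fintype.card_pos_iff.2 ⟨i₀⟩
  omega

/-! ### Bases of solutions -/

section Bases

variable {L : ℂ → ℂ} {p : Fin 1 → ℂ}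

theorem varpi_apply (k : ℕ) (p : Fin 1 → ℂ) (F : FormalGerm (Fin.cons 0 p : Fin 2 → ℂ))
    (ℓ : Fin k) : varpi k p F ℓ = slice p ℓ F := by
  have h : pderiv (Fin.cons 0 p : Fin 2 → ℂ) 0 = derivBase _ 0 := pderiv_castSucc _ 0
  change restrictZero p ((pderiv (Fin.cons 0 p : Fin 2 → ℂ) 0 ^ (ℓ : ℕ)) F) = _
  rw [h]
  rfl

theorem mem_SolSum_iff {d k : ℕ} {p : Fin d → ℂ} {A : Fin (d + 1) → ℕ} {β : ℂ} {s : ℝ}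
    {G : Fin k → FormalGerm p} :
    G ∈ SolSum k p A β s ↔ ∀ ℓ : Fin k, G ℓ ∈ Sol p A ((β - (ℓ : ℕ)) / k) s := by
  simp [SolSum, Submodule.mem_pi]

theorem psi_mem_Sol (hL : IsLogBranch L (p 0)) {a b : ℕ} (ha : 1 ≤ a) (hb : 0 < b)
    (hab : Nat.Coprime a b) (β : ℂ) {s : ℝ} (hs : (b : ℝ) / a ≤ s) (j : Fin a) :
    psi a b β hL j ∈ Sol p ![a, b] β s := by
  rw [psi_eq_mono, mono_mem_Sol_iff hL ha hb hab hs]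
  exact psiSeq_recurrence a b β j

theorem single_psi_mem_SolSum (hL : IsLogBranch L (p 0)) {a b k : ℕ} (ha : 1 ≤ a) (hb : 0 < b)
    (hab : Nat.Coprime a b) (β : ℂ) {s : ℝ} (hs : (b : ℝ) / a ≤ s) (i : Fin k × Fin a) :
    Pi.single i.1 (psi a b ((β - (i.1 : ℕ)) / k) hL i.2) ∈ SolSum k p ![a, b] β s := by
  rw [mem_SolSum_iff]
  intro ℓ
  by_cases h : ℓ = i.1
  · subst h
    rw [Pi.single_eq_same]
    exact psi_mem_Sol hL ha hb hab _ hs _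
  · rw [Pi.single_eq_of_ne h]
    exact zero_mem _

theorem varpi_mem_SolSum (hL : IsLogBranch L (p 0)) {a b k : ℕ} (ha : 1 ≤ a) (hb : 0 < b)
    (hk : 1 ≤ k) (hab : Nat.Coprime a b) {β : ℂ} {s : ℝ} (hs : (b : ℝ) / a ≤ s)
    {F : FormalGerm (Fin.cons 0 p : Fin 2 → ℂ)}
    (hF : F ∈ Sol (Fin.cons 0 p : Fin 2 → ℂ) ![1, k * a, k * b] β s) :
    varpi k p F ∈ SolSum k p ![a, b] β s := by
  obtain ⟨D, hD, hsl⟩ := exists_slice_eq_mono hL ha hk hF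
  rw [mem_SolSum_iff]
  intro ℓ
  rw [varpi_apply, hsl, mono_mem_Sol_iff hL ha hb hab hs]
  exact recurrence_of_slice ha hk hD ℓ

theorem sum_psiSeq_recurrence {a : ℕ} (b : ℕ) (β : ℂ) (c : Fin a → ℂ) (n : ℕ) :
    poch (eulerExp a b β n) b * (n.factorial * (∑ j, c j • psiSeq a b β j) n) =
      (n + a).factorial * (∑ j, c j • psiSeq a b β j) (n + a) := by
  simp only [Finset.sum_apply, Pi.smul_apply, smul_eq_mul, Finset.mul_sum]
  refine Finset.sum_congr rfl fun j _ => ?_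
  linear_combination c j * psiSeq_recurrence a b β j n

theorem sum_psiSeq_apply {a : ℕ} (b : ℕ) (β : ℂ) (c : Fin a → ℂ) (n : Fin a) :
    (∑ j, c j • psiSeq a b β j) n = c n := by
  simp only [Finset.sum_apply, Pi.smul_apply, smul_eq_mul, psiSeq_of_lt n.2, ← Fin.ext_iff]
  simp

theorem sum_smul_single_psi (hL : IsLogBranch L (p 0)) {a b k : ℕ} (β : ℂ)
    (c : Fin k × Fin a → ℂ) (ℓ : Fin k) :
    (∑ i : Fin k × Fin a, c i • (Pi.single i.1 (psi a b ((β - (i.1 : ℕ)) / k) hL i.2) :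
      Fin k → FormalGerm p)) ℓ =
      mono hL (eulerExp a b ((β - (ℓ : ℕ)) / k))
        (∑ j, c (ℓ, j) • psiSeq a b ((β - (ℓ : ℕ)) / k) j) := by
  rw [map_sum, Finset.sum_apply, Fintype.sum_prod_type,
    Finset.sum_eq_single ℓ (fun ℓ' _ h => ?_) (by simp)]
  · refine Finset.sum_congr rfl fun j _ => ?_
    rw [Pi.smul_apply, Pi.single_eq_same, psi_eq_mono, map_smul]
  · refine Finset.sum_eq_zero fun j _ => ?_
    rw [Pi.smul_apply, Pi.single_eq_of_ne h.symm, smul_zero]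

/-- The vectors with a single nonzero entry `ψ` form a basis of the direct sum. -/
theorem exists_basis_SolSum (hL : IsLogBranch L (p 0)) {a b : ℕ} (k : ℕ) (ha : 1 ≤ a) (hb : 0 < b)
    (hab : Nat.Coprime a b) (β : ℂ) {s : ℝ} (hs : (b : ℝ) / a ≤ s) :
    ∃ w : Module.Basis (Fin k × Fin a) ℂ (SolSum k p ![a, b] β s), ∀ i,
      (w i : Fin k → FormalGerm p) = Pi.single i.1 (psi a b ((β - (i.1 : ℕ)) / k) hL i.2) := by
  let v : Fin k × Fin a → SolSum k p ![a, b] β s := fun i =>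
    ⟨_, single_psi_mem_SolSum hL ha hb hab β hs i⟩
  have hv : ∀ (c : Fin k × Fin a → ℂ) (ℓ : Fin k),
      ((∑ i, c i • v i : SolSum k p ![a, b] β s) : Fin k → FormalGerm p) ℓ =
        mono hL (eulerExp a b ((β - (ℓ : ℕ)) / k))
          (∑ j, c (ℓ, j) • psiSeq a b ((β - (ℓ : ℕ)) / k) j) := by
    intro c ℓ
    rw [← sum_smul_single_psi hL, AddSubmonoidClass.coe_finsetSum]
    rfl
  -- In position `ℓ`, the coefficient of `x_2^j` with `j < a` reads off the scalar of `ψ^(j)`;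
  -- spanning follows from the same initial values.
  have hli : LinearIndependent ℂ v := by
    rw [Fintype.linearIndependent_iff]
    rintro g hg ⟨ℓ, j⟩
    have h1 := hv g ℓ
    rw [hg] at h1
    have h2 := congrFun (mono_injective hL _ ((map_zero (mono hL _)).trans h1)) j
    rw [sum_psiSeq_apply] at h2
    exact h2.symm
  refine ⟨Module.Basis.mk hli ?_, fun i => by rw [Module.Basis.mk_apply]⟩
  rintro ⟨G, hG⟩ -
  have h1 : ∀ ℓ, ∃ e, G ℓ = mono hL (eulerExp a b ((β - (ℓ : ℕ)) / k)) e := fun ℓ =>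
    exists_eq_mono_of_euler hL ha
      ((mem_Sol_two_iff hab hb).1 (mem_SolSum_iff.1 hG ℓ)).2.2
  choose e he using h1
  have h2 : (⟨G, hG⟩ : SolSum k p ![a, b] β s) = ∑ i, e i.1 i.2 • v i := by
    refine Subtype.ext (funext fun ℓ => ?_)
    have h3 := mem_SolSum_iff.1 hG ℓ
    rw [he, mono_mem_Sol_iff hL ha hb hab hs] at h3
    rw [hv fun i => e i.1 i.2]
    change G ℓ = _
    rw [he]
    congr 1
    exact eq_of_recurrence ha h3 (sum_psiSeq_recurrence b _ _) fun n hn =>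
      (sum_psiSeq_apply b _ (fun j => e ℓ j) ⟨n, hn⟩).symm
  rw [h2]
  exact Submodule.sum_mem _ fun i _ => Submodule.smul_mem _ _ (Submodule.subset_span ⟨i, rfl⟩)

/-- The sequence `D` of the solution of the system of `(1, ka, kb)` with index `i`. -/
def basisSeq (a b k : ℕ) (β : ℂ) (i : Fin k × Fin a) (l : ℕ) : ℂ :=
  if l % (k * a) = expResidue a b k i then weight (k * a) β l else 0

theorem basisSeq_recurrence {a k : ℕ} (b : ℕ) (hka : 0 < k * a) (β : ℂ) (i : Fin k × Fin a)
    (l : ℕ) : basisSeq a b k β i (l + k * a) =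
      (β - l) / (k * a : ℕ) * basisSeq a b k β i l := by
  rw [basisSeq, basisSeq, Nat.add_mod_right, weight_add hka]
  split_ifs <;> simp

theorem sum_smul_basisSeq {a b k : ℕ} (hab : Nat.Coprime a b) (hka : 0 < k * a) {β : ℂ}
    {D : ℕ → ℂ} (hD : ∀ l, D (l + k * a) = (β - l) / (k * a : ℕ) * D l) (l : ℕ) :
    ∑ i, D (expResidue a b k i) * basisSeq a b k β i l = D l := by
  obtain ⟨i, hi⟩ := exists_expResidue_eq (b := b) hab (Nat.mod_lt l hka)
  rw [Finset.sum_eq_single i]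
  · rw [basisSeq, if_pos hi.symm, hi, mul_comm, ← apply_eq_weight_mul hka hD]
  · intro j _ hj
    rw [basisSeq, if_neg, mul_zero]
    intro h
    exact hj ((expResidue_eq_iff hab).1 (h.symm.trans hi.symm))
  · simp

theorem exists_basis_Sol (hL : IsLogBranch L (p 0)) {a b k : ℕ} (ha : 1 ≤ a) (hb : 0 < b)
    (hk : 1 ≤ k) (hab : Nat.Coprime a b) (β : ℂ) {s : ℝ} (hs : (b : ℝ) / a ≤ s) :
    ∃ v : Module.Basis (Fin k × Fin a) ℂ
      (Sol (Fin.cons 0 p : Fin 2 → ℂ) ![1, k * a, k * b] β s), ∀ i l,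
      slice p l (v i : FormalGerm (Fin.cons 0 p : Fin 2 → ℂ)) =
        mono hL (eulerExp a b ((β - l) / k))
          fun n => basisSeq a b k β i (l + k * b * n) / n.factorial := by
  have hka : 0 < k * a := Nat.mul_pos hk ha
  have hex := fun i : Fin k × Fin a => exists_mem_Sol_slice hL ha hb hk hs
    (basisSeq_recurrence b hka β i)
  choose F hF hsl using hex
  let v : Fin k × Fin a → Sol (Fin.cons 0 p : Fin 2 → ℂ) ![1, k * a, k * b] β s := fun i =>
    ⟨F i, hF i⟩
  have hv : ∀ (c : Fin k × Fin a → ℂ) (l : ℕ),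
      slice p l (∑ i, c i • v i : Sol (Fin.cons 0 p : Fin 2 → ℂ) ![1, k * a, k * b] β s).1 =
        mono hL (eulerExp a b ((β - l) / k)) fun n =>
          (∑ i, c i * basisSeq a b k β i (l + k * b * n)) / n.factorial := by
    intro c l
    have h1 : (∑ i, c i • v i : Sol (Fin.cons 0 p : Fin 2 → ℂ) ![1, k * a, k * b] β s).1 =
        ∑ i, c i • F i := by
      rw [AddSubmonoidClass.coe_finsetSum]; rfl
    rw [h1, map_sum]
    simp only [map_smul, hsl]
    simp only [← map_smul]
    rw [← map_sum]
    congr 1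
    funext n
    simp [Finset.sum_apply, Finset.sum_div, mul_div_assoc]
  have hli : LinearIndependent ℂ v := by
    rw [Fintype.linearIndependent_iff]
    intro g hg i
    have hlt : expResidue a b k i < k * a := Nat.mod_lt _ hka
    -- At `n = 0` in the slice whose index is the residue of `i`, only the `i`-th sequence is
    -- nonzero, and its value there is `1` because the residue is below `ka`.
    have h1 := hv g (expResidue a b k i)
    rw [hg] at h1
    have h2 := congrFun (mono_injective hL _ (h1.symm.trans
      ((map_zero (slice p _)).trans (map_zero (mono hL _)).symm))) 0
    simp only [mul_zero, add_zero, Nat.factorial_zero, Nat.cast_one, div_one, Pi.zero_apply] at h2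
    rw [Finset.sum_eq_single i] at h2
    · rwa [basisSeq, if_pos (Nat.mod_eq_of_lt hlt), weight_of_lt β hlt, mul_one] at h2
    · intro j _ hj
      rw [basisSeq, if_neg, mul_zero]
      intro h
      rw [Nat.mod_eq_of_lt hlt] at h
      exact hj ((expResidue_eq_iff hab).1 h.symm)
    · simp
  refine ⟨Module.Basis.mk hli ?_, fun i l => by rw [Module.Basis.mk_apply]; exact hsl i l⟩
  rintro ⟨G, hG⟩ -
  obtain ⟨D, hD, hGs⟩ := exists_slice_eq_mono hL ha hk hG
  have h2 : (⟨G, hG⟩ : Sol (Fin.cons 0 p : Fin 2 → ℂ) ![1, k * a, k * b] β s) =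
      ∑ i, D (expResidue a b k i) • v i := by
    refine Subtype.ext (sub_eq_zero.1 (eq_zero_of_restrictZero_derivBase_pow fun l => ?_))
    change slice p l _ = 0
    rw [map_sub, sub_eq_zero, hv, hGs]
    simp only [sum_smul_basisSeq hab hka hD]
  rw [h2]
  exact Submodule.sum_mem _ fun i _ => Submodule.smul_mem _ _ (Submodule.subset_span ⟨i, rfl⟩)

/-- Both sides solve the plane system in each position `ℓ`, so comparing coefficients of `x_2ⁿ` for
`n < a` suffices. There `D_{ℓ+kbn}` is nonzero at most for `(ℓ, n) = i`, as distinct pairs have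
distinct residues. -/
theorem varpi_eq_weight_smul (hL : IsLogBranch L (p 0)) {a b k : ℕ} (ha : 1 ≤ a) (hk : 1 ≤ k)
    (hab : Nat.Coprime a b) {β : ℂ} (i : Fin k × Fin a)
    {F : FormalGerm (Fin.cons 0 p : Fin 2 → ℂ)} (hF : ∀ l : ℕ, slice p l F =
      mono hL (eulerExp a b ((β - l) / k))
        fun n => basisSeq a b k β i (l + k * b * n) / n.factorial) :
    varpi k p F = (weight (k * a) β (i.1 + k * b * i.2) / (i.2 : ℕ).factorial) •
      (Pi.single i.1 (psi a b ((β - (i.1 : ℕ)) / k) hL i.2) : Fin k → FormalGerm p) := by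
  set c := weight (k * a) β (i.1 + k * b * i.2) / (i.2 : ℕ).factorial
  have hka : 0 < k * a := Nat.mul_pos hk ha
  funext ℓ
  have h1 := sum_smul_single_psi (b := b) hL β (Pi.single i c) ℓ
  rw [Finset.sum_eq_single i (fun j _ hj => by rw [Pi.single_eq_of_ne hj, zero_smul]) (by simp),
    Pi.single_eq_same] at h1
  rw [varpi_apply, hF, h1]
  congr 1
  refine eq_of_recurrence ha (recurrence_of_slice ha hk (basisSeq_recurrence b hka β i) ℓ)
    (sum_psiSeq_recurrence b _ _) fun n hn => ?_
  refine Eq.trans ?_ (sum_psiSeq_apply b _ _ ⟨n, hn⟩).symm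
  rw [basisSeq]
  split_ifs with h
  · obtain rfl := (expResidue_eq_iff (j := (ℓ, ⟨n, hn⟩)) hab).1 h
    rw [Pi.single_eq_same]
  · rw [Pi.single_eq_of_ne, zero_div]
    rintro rfl
    exact h rfl

end Bases

end GevreyGKZ

end

/-! ### The theorem: counting the vanishing diagonal entries of `ϖ`. -/

open GevreyGKZ in
theorem mainTheorem4 (a b k : ℕ) (ha : 1 ≤ a) (hab : a < b) (hgcd : Nat.Coprime a b)
    (hk : 1 ≤ k) (hka : 1 < k * a) (β : ℂ) (s : ℝ) (hs : (b : ℝ) / a ≤ s)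
    (p : Fin 1 → ℂ) (hp : p 0 ≠ 0) :
    ∃ hwd : ∀ φ ∈ Sol (Fin.cons 0 p) ![1, k * a, k * b] β s,
        varpi k p φ ∈ SolSum k p ![a, b] β s,
      (((∀ n : ℕ, β ≠ n) ∨ (∃ r < k, ∃ c ∈ semigroup a b, β = (r : ℂ) + k * c)) →
        Function.Bijective ((varpi k p).restrict hwd)) ∧
      ((∃ r < k, ∃ c : ℕ, c ∉ semigroup a b ∧ β = (r : ℂ) + k * c) →
        (∃! t : ℕ × Fin k × ℕ × ℤ × Fin a,
          IsExceptional a b k β t.1 t.2.1 t.2.2.1 t.2.2.2.1 t.2.2.2.2) ∧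
        ∀ (j₀ : ℕ) (r₀ : Fin k) (q₀ : ℕ) (h : ℤ) (j₀' : Fin a),
          IsExceptional a b k β j₀ r₀ q₀ h j₀' →
          Module.finrank ℂ
              (SolSum k p ![a, b] β s ⧸ LinearMap.range ((varpi k p).restrict hwd)) = 1 ∧
          ∀ (L : ℂ → ℂ) (hL : IsLogBranch L (p 0)),
            Submodule.map (varpi k p) (Sol (Fin.cons 0 p) ![1, k * a, k * b] β s) =
              Submodule.span ℂ
                {F | ∃ (r : Fin k) (j' : Fin a), (j', r) ≠ (j₀', r₀) ∧
                  F = Pi.single r (psi a b ((β - (r : ℕ)) / k) hL j')}) := by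
  have hb : 0 < b := by omega
  have hk0 : 0 < k := by omega
  obtain ⟨L₀, hL₀⟩ := exists_isLogBranch hp
  have hwd : ∀ φ ∈ Sol (Fin.cons 0 p) ![1, k * a, k * b] β s,
      varpi k p φ ∈ SolSum k p ![a, b] β s := fun φ hφ =>
    varpi_mem_SolSum hL₀ ha hb hk hgcd hs hφ
  -- The bases depend on the branch of the logarithm and the generators of the image are claimed for
  -- every branch, so `L` stays arbitrary; `L₀` serves for the branch-free assertions.
  have hdiag : ∀ (L : ℂ → ℂ) (hL : IsLogBranch L (p 0)),
      ∃ (v : Module.Basis (Fin k × Fin a) ℂ (Sol (Fin.cons 0 p) ![1, k * a, k * b] β s))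
        (w : Module.Basis (Fin k × Fin a) ℂ (SolSum k p ![a, b] β s)),
        (∀ i, (w i : Fin k → FormalGerm p) =
          Pi.single i.1 (psi a b ((β - (i.1 : ℕ)) / k) hL i.2)) ∧
        ∀ i, (varpi k p).restrict hwd (v i) =
          (weight (k * a) β (i.1 + k * b * i.2) / (i.2 : ℕ).factorial) • w i := by
    intro L hL
    obtain ⟨v, hv⟩ := exists_basis_Sol hL ha hb hk hgcd β hs
    obtain ⟨w, hw⟩ := exists_basis_SolSum hL k ha hb hgcd β hs
    refine ⟨v, w, hw, fun i => Subtype.ext ?_⟩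
    refine (varpi_eq_weight_smul hL ha hk hgcd i (hv i)).trans ?_
    rw [← hw]
    rfl
  have hfac : ∀ i : Fin k × Fin a,
      weight (k * a) β (i.1 + k * b * i.2) / ((i.2 : ℕ).factorial : ℂ) = 0 ↔
        weight (k * a) β (i.1 + k * b * i.2) = 0 := fun i => by
    rw [div_eq_zero_iff, or_iff_left (Nat.cast_ne_zero.2 (Nat.factorial_ne_zero _))]
  refine ⟨hwd, fun hβ => ?_, ?_⟩
  · obtain ⟨v, w, -, hvw⟩ := hdiag L₀ hL₀
    refine bijective_of_diagonal _ v w hvw fun i hi => ?_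
    rw [hfac] at hi
    rcases hβ with hβ | ⟨r, hr, c, hc, hβ⟩
    · obtain ⟨N, hN, -⟩ := (weight_eq_zero_iff (by omega) β _).1 hi
      exact hβ N hN
    · exact ((weight_eq_zero_iff_of_natCast hgcd hr hβ i).1 hi).1 hc
  · rintro ⟨r, hr, c, hc, hβ⟩
    have hβ' : β = (((⟨r, hr⟩ : Fin k) : ℕ) : ℂ) + k * c := hβ
    refine ⟨existsUnique_isExceptional ha hgcd hβ', fun j₀ r₀ q₀ h j₀' hex => ?_⟩
    obtain ⟨-, hr₀, -, -, hj₀'⟩ := (isExceptional_iff ha hβ' j₀ r₀ q₀ h j₀').1 hex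
    -- The unique vanishing entry is the exceptional index: coprimality makes `j₀'` the only
    -- solution of `bj ≡ c (mod a)` with `j < a`.
    have hzero : ∀ i : Fin k × Fin a,
        weight (k * a) β (i.1 + k * b * i.2) / ((i.2 : ℕ).factorial : ℂ) = 0 ↔
          i = (r₀, j₀') := by
      intro i
      rw [hfac, weight_eq_zero_iff_of_natCast hgcd hr hβ, hr₀]
      constructor
      · rintro ⟨-, h1, h2⟩
        exact Prod.ext (Fin.ext h1) (eq_of_mul_mod_eq hgcd (h2.trans hj₀'.symm))
      · rintro rfl
        exact ⟨hc, rfl, hj₀'⟩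
    obtain ⟨v₀, w₀, -, hvw₀⟩ := hdiag L₀ hL₀
    refine ⟨finrank_quotient_range_of_diagonal _ v₀ w₀ hvw₀ hzero, fun L hL => ?_⟩
    obtain ⟨v, w, hw, hvw⟩ := hdiag L hL
    have hmap : Submodule.map (varpi k p) (Sol (Fin.cons 0 p) ![1, k * a, k * b] β s) =
        (LinearMap.range ((varpi k p).restrict hwd)).map (SolSum k p ![a, b] β s).subtype := by
      ext G
      constructor
      · rintro ⟨F, hF, rfl⟩
        exact ⟨_, ⟨⟨F, hF⟩, rfl⟩, rfl⟩
      · rintro ⟨_, ⟨⟨F, hF⟩, rfl⟩, rfl⟩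
        exact ⟨F, hF, rfl⟩
    rw [hmap, range_of_diagonal _ v w hvw hzero, Submodule.map_span]
    congr 1
    ext G
    constructor
    · rintro ⟨_, ⟨⟨⟨ℓ, j⟩, hi⟩, rfl⟩, rfl⟩
      refine ⟨ℓ, j, fun h1 => hi ?_, hw (ℓ, j)⟩
      rw [Prod.mk.injEq] at h1 ⊢
      exact h1.symm
    · rintro ⟨ℓ, j, hi, rfl⟩
      refine ⟨w (ℓ, j), ⟨⟨(ℓ, j), fun h1 => hi ?_⟩, rfl⟩, hw (ℓ, j)⟩
      rw [Prod.mk.injEq] at h1 ⊢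
      exact h1.symm
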